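/- **Global dual basis.** Let $d,k\ge 1$. Let $\Omega\subset\mathbb R^d$ be a bounded polyhedral domain (open, connected, $\overline\Omega$ a finite union of polytopes) which equals the interior of its closure and is locally connected at its boundary, i.e. every $x\in\partial\Omega$ has arbitrarily small open neighbourhoods $V$ with $V\cap\Omega$ connected (for instance, a Lipschitz polyhedral domain). Let $\mathcal T$ be a (finite, conforming) triangulation of $\overline\Omega$ into closed, nondegenerate $d$-simplices. For $T\in\mathcal T$ let $(\lambda_v)_v$ denote its barycentric coordinates, indexed by the vertices $v$ of $T$. Let $\mathcal N$ be the set of Lagrange nodes of order $k$, i.e. of the points $\sum_{v}\frac{\alpha_v}{k}v$, where $T\in\mathcal T$, $v$ runs through the vertices of $T$, and $\alpha$ is a multi-index on these vertices with $|\alpha|=k$. For $i\in\mathcal N$ let $\mathcal T(\omega_i)=\{T\in\mathcal T: i\in T\}$ and $\omega_i=\bigcup\mathcal T(\omega_i)$, and let $b_i$ be the Bernstein basis function: $b_i|_T=\frac{k!}{\alpha!}\lambda^\alpha$ with $\alpha_v=k\lambda_v(i)$ for $T\in\mathcal T(\omega_i)$, and $b_i=0$ outside $\omega_i$. Let $\mathcal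 L^1_m(\mathcal T)$ be the space of $W^{1,1}(\Omega)$-functions whose restriction to each (closed) $T\in\mathcal T$ is a polynomial of degree at most $m$ (these are continuous on $\overline\Omega$), and let $\mathcal L^1_m(\omega_i)$ be the analogous space for $\mathcal T(\omega_i)$ on the interior of $\omega_i$. Write $\langle f,g\rangle_\Omega=\int_\Omega fg\,\mathrm dx$. Call $\mathcal T$ shape regular with constant $\gamma$ if every $T\in\mathcal T$ contains a ball of some radius $r>0$ with $\operatorname{diam}(T)\le\gamma r$ and, in the case $d=1$, moreover $\operatorname{diam}(T)\le\gamma\operatorname{diam}(T')$ for all $T,T'\in\mathcal T$ with $T\cap T'\ne\emptyset$. Then there are a constant $C_1$ depending only on $d$ and $k$, and constants $C_2(\gamma)$ depending only on $d$, $k$ and $\gamma$, such that for all such $\Omega$ and $\mathcal T$ there exist functions $\psi_i\in\mathcal L^1_{3k}(\mathcal T)$, $i\in\mathcal N$, with the following properties. 1. (Product structure) For each $i\in\mathcal N$ there is $\zeta_i\in\mathcal L^1_{2k}(\omega_i)$ with $\psi_i=b_i\zeta_i$ (understood as $0$ outside $\omega_i$); in particular $\operatorname{supp}\psi_i\subset\operatorname{supp}b_i$.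 2. (Biorthogonality) $\langle b_i,\psi_j\rangle_\Omega=\delta_{i,j}$ for all $i,j\in\mathcal N$. 3. (Boundedness) For all $i\in\mathcal N$, $$\|\psi_i\|_{L^\infty(\omega_i)}\le C_1\,|\omega_i|^{-1},$$ and, whenever $\mathcal T$ is shape regular with constant $\gamma$, $$\|\nabla\psi_i\|_{L^\infty(\omega_i)}\le C_2(\gamma)\,\operatorname{diam}(\omega_i)^{-1}|\omega_i|^{-1}.$$ 4. (Preservation of mass) $\sum_{i\in\mathcal N}\langle 1,b_i\rangle_\Omega\,\psi_i=1$ on $\overline\Omega$. -/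

import Mathlib

open MeasureTheory Set
open scoped ContDiff ENNReal Topology

noncomputable section

namespace LagrangeFE

/-- The Euclidean space `ℝ^d`. -/
abbrev Eu (d : ℕ) := EuclideanSpace ℝ (Fin d)

/-! ### Sobolev functions -/

/-- `g` is the weak gradient of `v` on the open set `U`. -/
def HasWeakGradient {d : ℕ} (U : Set (Eu d)) (v : Eu d → ℝ) (g : Eu d → Eu d) : Prop :=
  ∀ φ : Eu d → ℝ, ContDiff ℝ ∞ φ → HasCompactSupport φ → tsupport φ ⊆ U → ∀ e : Eu d,
    ∫ x in U, v x * fderiv ℝ φ x e = - ∫ x in U, inner ℝ (g x) e * φ x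

/-- `v ∈ W^{1,1}(U)`. -/
def MemW11 {d : ℕ} (U : Set (Eu d)) (v : Eu d → ℝ) : Prop :=
  IntegrableOn v U ∧ ∃ g : Eu d → Eu d, IntegrableOn g U ∧ HasWeakGradient U v g

/-! ### Domains and triangulations -/

/-- A bounded polyhedral domain. The last two conditions say that the domain lies locally on one
side of its boundary and that its boundary has no pinch points; every Lipschitz domain has both
properties. Boundedness is part of `polyhedral`. -/
structure IsPolyhedralDomain {d : ℕ} (Ω : Set (Eu d)) : Prop where
  isOpen : IsOpen Ω
  isConnected : IsConnected Ω
  polyhedral : ∃ P : Finset (Finset (Eu d)), closure Ω = ⋃ p ∈ P, convexHull ℝ (p : Set (Eu d))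
  interior_closure : interior (closure Ω) = Ω
  connected_at_boundary : ∀ x ∈ frontier Ω, ∀ U ∈ 𝓝 x,
    ∃ V ⊆ U, IsOpen V ∧ x ∈ V ∧ IsConnected (V ∩ Ω)

/-- A (conforming) triangulation of `Ω`: a finite simplicial complex with underlying space the
closure of `Ω`, each of whose faces is a face of a `d`-simplex of the complex. Simplices are
represented by their finite sets of vertices. -/
structure Triangulation {d : ℕ} (Ω : Set (Eu d)) extends Geometry.SimplicialComplex ℝ (Eu d) where
  finite_faces : faces.Finite
  exists_cell : ∀ s ∈ faces, ∃ t ∈ faces, s ⊆ t ∧ t.card = d + 1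
  space_eq : toSimplicialComplex.space = closure Ω

/-- The closed simplex spanned by a finite set of vertices. -/
def simplex {d : ℕ} (T : Finset (Eu d)) : Set (Eu d) := convexHull ℝ (T : Set (Eu d))

open Classical in
/-- The barycentric coordinate `λ_v` of the nondegenerate `d`-simplex with vertex set `T`, as an
affine function on the whole space; by convention it is `0` if `v` is not a vertex of `T`. -/
def bary {d : ℕ} (T : Finset (Eu d)) (v x : Eu d) : ℝ :=
  if h : AffineIndependent ℝ ((↑) : T → Eu d) ∧
      affineSpan ℝ (range ((↑) : T → Eu d)) = ⊤ ∧ v ∈ T then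
    (AffineBasis.mk ((↑) : T → Eu d) h.1 h.2.1).coord ⟨v, h.2.2⟩ x
  else 0

/-- The multi-index `α(i,T)` of a Lagrange node `i` of order `k` in the simplex `T`: its entries
are `k λ_v(i)`, which are natural numbers (see `multiIndex_node`). -/
def multiIndex {d : ℕ} (k : ℕ) (T : Finset (Eu d)) (i v : Eu d) : ℕ := ⌊k * bary T v i⌋₊

/-- The Bernstein polynomial `b_α = |α|! / α! λ^α` of the simplex `T`. -/
def bernsteinLocal {d : ℕ} (T : Finset (Eu d)) (α : Eu d → ℕ) (x : Eu d) : ℝ :=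
  (Nat.factorial (∑ v ∈ T, α v) : ℝ) / (∏ v ∈ T, (Nat.factorial (α v) : ℝ)) *
    ∏ v ∈ T, bary T v x ^ α v

/-- `f` restricted to the set `S` is a polynomial of total degree at most `m`. -/
def IsPolyOn {d : ℕ} (m : ℕ) (S : Set (Eu d)) (f : Eu d → ℝ) : Prop :=
  ∃ p : MvPolynomial (Fin d) ℝ, p.totalDegree ≤ m ∧
    ∀ x ∈ S, f x = MvPolynomial.eval (fun j => x j) p

/-- The Lagrange space of order `m` on the open set `U`, whose closure is the union of the simplices
in `C`: the `W^{1,1}(U)`-functions whose restriction to each simplex in `C` is a polynomial of degree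
at most `m`. Since the simplices are closed, such a function is continuous on their union. -/
def lagrangeSpace {d : ℕ} (U : Set (Eu d)) (C : Finset (Finset (Eu d))) (m : ℕ) :
    Set (Eu d → ℝ) :=
  {f | MemW11 U f ∧ ∀ T ∈ C, IsPolyOn m (simplex T) f}

namespace Triangulation

variable {d : ℕ} {Ω : Set (Eu d)} (𝒯 : Triangulation Ω)

open Classical in
/-- The `d`-simplices of the triangulation. -/
def cells : Finset (Finset (Eu d)) := {T ∈ 𝒯.finite_faces.toFinset | T.card = d + 1}

open Classical in
/-- The Lagrange nodes of order `k`: the points `∑ (α_v / k) v` for the `d`-simplices `T` and the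
multi-indices `α` on the vertices of `T` with `|α| = k`. -/
def nodes (k : ℕ) : Finset (Eu d) :=
  𝒯.cells.biUnion fun T => (T.piAntidiag k).image fun α => ∑ v ∈ T, ((α v : ℝ) / k) • v

open Classical in
/-- The `d`-simplices that contain the point `i`. -/
def cellsAt (i : Eu d) : Finset (Finset (Eu d)) := {T ∈ 𝒯.cells | i ∈ simplex T}

/-- The patch `ω_i`, the union of the `d`-simplices that contain `i`. -/
def patch (i : Eu d) : Set (Eu d) := ⋃ T ∈ 𝒯.cellsAt i, simplex T

open Classical in
/-- The global Bernstein basis function `b_i` of order `k`. On a simplex that contains `i` it is the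
local Bernstein polynomial for `α(i,T)` (by `bernstein_eq` the value does not depend on the choice
of the simplex `T` containing `i` and `x`), elsewhere it vanishes. -/
def bernstein (k : ℕ) (i x : Eu d) : ℝ :=
  if h : ∃ T ∈ 𝒯.cellsAt i, x ∈ simplex T then
    bernsteinLocal h.choose (multiIndex k h.choose i) x
  else 0

/-- Shape regularity with constant `γ`: the diameter of each simplex is at most `γ` times the radius
of some ball that it contains. For `d = 1` this is void, and shape regularity means that
the lengths of touching intervals are comparable. -/
def ShapeRegular (γ : ℝ) : Prop :=
  (∀ T ∈ 𝒯.cells, ∃ c : Eu d, ∃ r : ℝ, 0 < r ∧ Metric.closedBall c r ⊆ simplex T ∧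
    Metric.diam (simplex T) ≤ γ * r) ∧
  (d = 1 → ∀ T ∈ 𝒯.cells, ∀ T' ∈ 𝒯.cells, (simplex T ∩ simplex T').Nonempty →
    Metric.diam (simplex T) ≤ γ * Metric.diam (simplex T'))

/-! ### The global Bernstein functions are well defined -/

theorem mem_cells {T : Finset (Eu d)} : T ∈ 𝒯.cells ↔ T ∈ 𝒯.faces ∧ T.card = d + 1 := by
  simp [cells]

theorem indep_of_cells {T : Finset (Eu d)} (hT : T ∈ 𝒯.cells) :
    AffineIndependent ℝ ((↑) : T → Eu d) := 𝒯.indep (𝒯.mem_cells.1 hT).1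

theorem span_of_cells {T : Finset (Eu d)} (hT : T ∈ 𝒯.cells) :
    affineSpan ℝ (range ((↑) : T → Eu d)) = ⊤ := by
  rw [(𝒯.indep_of_cells hT).affineSpan_eq_top_iff_card_eq_finrank_add_one]
  simp [(𝒯.mem_cells.1 hT).2]

theorem bary_of_notMem {T : Finset (Eu d)} {v : Eu d} (hv : v ∉ T) (x : Eu d) :
    bary T v x = 0 := by
  simp [bary, hv]

/-- Barycentric coordinates are determined by the affine representation of a point. -/
theorem bary_sum {T : Finset (Eu d)} (hT : T ∈ 𝒯.cells) (w : Eu d → ℝ)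
    (hw : ∑ v ∈ T, w v = 1) {v : Eu d} (hv : v ∈ T) :
    bary T v (∑ u ∈ T, w u • u) = w v := by
  have h1 : ∑ u : T, w u = 1 := by rw [Finset.sum_coe_sort T w]; exact hw
  have h2 : ∑ u ∈ T, w u • u
      = Finset.univ.affineCombination ℝ ((↑) : T → Eu d) (fun u : T => w u) := by
    rw [Finset.affineCombination_eq_linear_combination _ _ _ h1,
      Finset.sum_coe_sort T (fun u => w u • u)]
  rw [bary, dif_pos ⟨𝒯.indep_of_cells hT, 𝒯.span_of_cells hT, hv⟩, h2]
  exact AffineBasis.coord_apply_combination_of_mem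
    (AffineBasis.mk ((↑) : T → Eu d) (𝒯.indep_of_cells hT) (𝒯.span_of_cells hT))
    (s := Finset.univ) (i := ⟨v, hv⟩) (Finset.mem_univ _) h1

/-- At the Lagrange node given by `α`, the multi-index is `α`. -/
theorem multiIndex_node {k : ℕ} (hk : 1 ≤ k) {T : Finset (Eu d)} (hT : T ∈ 𝒯.cells)
    (α : Eu d → ℕ) (hα : ∑ v ∈ T, α v = k) {v : Eu d} (hv : v ∈ T) :
    multiIndex k T (∑ u ∈ T, ((α u : ℝ) / k) • u) v = α v := by
  have hk' : (k : ℝ) ≠ 0 := by positivity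
  have h1 : ∑ u ∈ T, ((α u : ℝ) / k) = 1 := by
    rw [← Finset.sum_div, ← Nat.cast_sum, hα, div_self hk']
  rw [multiIndex, 𝒯.bary_sum hT _ h1 hv, mul_div_cancel₀ _ hk', Nat.floor_natCast]

/-- On the intersection of two cells the barycentric coordinates agree. -/
theorem bary_eq_of_mem {T T' : Finset (Eu d)} (hT : T ∈ 𝒯.cells) (hT' : T' ∈ 𝒯.cells)
    {x : Eu d} (hx : x ∈ simplex T) (hx' : x ∈ simplex T') (v : Eu d) :
    bary T v x = bary T' v x := by
  classical
  have h := 𝒯.inter_subset_convexHull (𝒯.mem_cells.1 hT).1 (𝒯.mem_cells.1 hT').1 ⟨hx, hx'⟩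
  rw [← Finset.coe_inter, Finset.mem_convexHull'] at h
  obtain ⟨w, -, hw1, hwx⟩ := h
  have key : ∀ S ∈ 𝒯.cells, T ∩ T' ⊆ S →
      bary S v x = if v ∈ T ∩ T' then w v else 0 := by
    intro S hS hsub
    let w' : Eu d → ℝ := fun u => if u ∈ T ∩ T' then w u else 0
    have e1 : ∑ u ∈ S, w' u = 1 := by
      rw [← hw1, ← Finset.sum_subset hsub (f := w')]
      · exact Finset.sum_congr rfl fun u hu => if_pos hu
      · intro u _ hu; exact if_neg hu
    have e2 : ∑ u ∈ S, w' u • u = x := by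
      rw [← hwx, ← Finset.sum_subset hsub (f := fun u => w' u • u)]
      · exact Finset.sum_congr rfl fun u hu => by simp only [w', if_pos hu]
      · intro u _ hu; simp only [w', if_neg hu, zero_smul]
    by_cases hv : v ∈ S
    · rw [← e2, 𝒯.bary_sum hS w' e1 hv]
    · rw [bary_of_notMem hv, if_neg fun h => hv (hsub h)]
  rw [key T hT Finset.inter_subset_left, key T' hT' Finset.inter_subset_right]

/-- The local formula for `b_i` on every cell that contains `i`. -/
theorem bernstein_eq (k : ℕ) {i x : Eu d} {T : Finset (Eu d)} (hT : T ∈ 𝒯.cellsAt i)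
    (hx : x ∈ simplex T) :
    𝒯.bernstein k i x = bernsteinLocal T (multiIndex k T i) x := by
  classical
  have h : ∃ T ∈ 𝒯.cellsAt i, x ∈ simplex T := ⟨T, hT, hx⟩
  rw [bernstein, dif_pos h]
  obtain ⟨hS, hxS⟩ := h.choose_spec
  generalize h.choose = S at hS hxS
  simp only [cellsAt, Finset.mem_filter] at hT hS
  have hα : multiIndex k S i = multiIndex k T i := by
    funext v; rw [multiIndex, multiIndex, 𝒯.bary_eq_of_mem hS.1 hT.1 hS.2 hT.2 v]
  have h0 : ∀ R : Finset (Eu d), ∀ v, v ∉ R → multiIndex k R i v = 0 := by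
    intro R v hv; simp [multiIndex, bary_of_notMem hv]
  have hl : ∀ v, bary S v x = bary T v x := 𝒯.bary_eq_of_mem hS.1 hT.1 hxS hx
  have hu : ∀ R : Finset (Eu d), (∀ v ∉ R, multiIndex k T i v = 0) → R ⊆ S ∪ T →
      (∀ v, bary R v x = bary T v x) →
      bernsteinLocal R (multiIndex k T i) x =
        (Nat.factorial (∑ v ∈ S ∪ T, multiIndex k T i v) : ℝ) /
          (∏ v ∈ S ∪ T, (Nat.factorial (multiIndex k T i v) : ℝ)) *
          ∏ v ∈ S ∪ T, bary T v x ^ multiIndex k T i v := by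
    intro R hR hsub hb
    unfold bernsteinLocal
    rw [Finset.sum_subset hsub fun v _ hv => hR v hv,
      Finset.prod_subset hsub (f := fun v => (Nat.factorial (multiIndex k T i v) : ℝ))
        fun v _ hv => by simp [hR v hv],
      Finset.prod_subset hsub (f := fun v => bary R v x ^ multiIndex k T i v)
        fun v _ hv => by simp [hR v hv]]
    simp only [hb]
  rw [hα, hu S (fun v hv => hα ▸ h0 S v hv) Finset.subset_union_left hl,
    hu T (h0 T) Finset.subset_union_right fun _ => rfl]

end Triangulation

end LagrangeFE

end

/-! Everything reduces to one simplex. Let `I` be the normalized integral over a reference simplex,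
B_α the Bernstein polynomials of degree k in barycentric coordinates. It suffices to find
polynomials Z_α of degree at most 2k with I(B_β B_α Z_α) = δ_{αβ} and Σ_α I(B_α) B_α Z_α = 1 that
are equivariant under permutations of the vertices. Then ζ_i = |ω_i|⁻¹ Z_{α(i,T)}(λ^T) on each cell
T at i, and ψ_i = b_i ζ_i. Equivariance makes the pieces agree on common faces
(`exists_isDualFactor`). A cell T of ω_i contributes |T|/|ω_i| to ⟨b_i, ψ_i⟩, and these weights sum
to 1. Since ⟨1, b_i⟩ = |ω_i| I(B_α), the volumes also cancel in the mass identity.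

For the local problem (`exists_local_dual`) put Z_α = I(B_α)⁻¹ (q_α - Q + 1), where the q_α are
unknown polynomials in the span of the B_β and Q = Σ_α B_α q_α is their mean for the weights B_α. As
these weights sum to 1, the mass identity holds for every choice of q. Biorthogonality becomes a
linear system for q whose form is a covariance, I(Σ_α B_α (q_α - Q) p_α), hence positive
semidefinite. By `exists_eq_of_forall_null` it is solvable as soon as the right-hand side vanishes
on the null vectors. A null vector has zero variance, so all its p_α coincide
(`row_eq_of_covForm_eq_zero`), and for such p the right-hand side is zero (`dualRhs_eq_zero`).
Averaging over all permutations gives equivariance and keeps the other properties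
(`exists_equivariant_local_dual`).

The sup bound is the maximum of finitely many polynomials on the standard simplex. For the gradient,
barycentric coordinates have Lipschitz constant (2r)⁻¹ when the cell contains a ball of radius r, so
r must be compared with diam ω_i. Shape regularity bounds the number of cells at a point
(`ShapeRegular.card_cellsAt_le`) and makes cells with a common edge comparable. For d ≥ 2 any two
cells at a point are joined by a chain of such cells (`edgeGraph_preconnected`); this is where
connectedness of Ω near boundary points enters. For d = 1 comparability is part of shape regularity.
-/

noncomputable section

namespace LagrangeFE

/-! ### The dual basis on the reference simplex -/

section Reference

open MvPolynomial

variable {ι : Type*} [Fintype ι]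

/-- The Bernstein polynomial with multi-index `α` in barycentric coordinates. -/
def bernPoly (α : ι → ℕ) : MvPolynomial ι ℝ :=
  C ((Nat.factorial (∑ j, α j) : ℝ) / ∏ j, (Nat.factorial (α j) : ℝ)) * ∏ j, X j ^ α j

theorem eval_bernPoly (α : ι → ℕ) (x : ι → ℝ) :
    eval x (bernPoly α) =
      (Nat.factorial (∑ j, α j) : ℝ) / (∏ j, (Nat.factorial (α j) : ℝ)) * ∏ j, x j ^ α j := by
  simp [bernPoly]

theorem totalDegree_bernPoly_le (α : ι → ℕ) : (bernPoly α).totalDegree ≤ ∑ j, α j := by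
  refine (totalDegree_mul _ _).trans ?_
  rw [totalDegree_C, zero_add]
  refine (totalDegree_finsetProd _ _).trans (Finset.sum_le_sum fun j _ => ?_)
  exact (totalDegree_X_pow j (α j)).le

theorem eval_bernPoly_comp_perm (σ : Equiv.Perm ι) (α : ι → ℕ) (x : ι → ℝ) :
    eval (x ∘ σ) (bernPoly (α ∘ σ)) = eval x (bernPoly α) := by
  simp only [eval_bernPoly, Function.comp_apply]
  rw [Equiv.sum_comp σ α, Equiv.prod_comp σ fun j => (Nat.factorial (α j) : ℝ),
    Equiv.prod_comp σ fun j => x j ^ α j]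

theorem rename_perm_bernPoly (σ : Equiv.Perm ι) (α : ι → ℕ) :
    rename σ (bernPoly (α ∘ σ)) = bernPoly α :=
  MvPolynomial.funext fun x => by rw [eval_rename, eval_bernPoly_comp_perm]

theorem eval_bernPoly_nonneg (α : ι → ℕ) {x : ι → ℝ} (hx : ∀ j, 0 ≤ x j) :
    0 ≤ eval x (bernPoly α) := by
  rw [eval_bernPoly]
  have := Finset.prod_nonneg fun j (_ : j ∈ Finset.univ) => pow_nonneg (hx j) (α j)
  positivity

theorem eval_bernPoly_pos (α : ι → ℕ) {x : ι → ℝ} (hx : ∀ j, 0 < x j) :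
    0 < eval x (bernPoly α) := by
  rw [eval_bernPoly]
  have := Finset.prod_pos fun j (_ : j ∈ Finset.univ) => pow_pos (hx j) (α j)
  have : 0 < ∏ j, (Nat.factorial (α j) : ℝ) :=
    Finset.prod_pos fun j _ => by exact_mod_cast Nat.factorial_pos _
  positivity

/-- A functional on polynomials in barycentric coordinates that behaves like the integral over the
reference simplex. -/
structure IsSimplexIntegral (I : MvPolynomial ι ℝ →ₗ[ℝ] ℝ) : Prop where
  congr : ∀ p q, (∀ x ∈ stdSimplex ℝ ι, eval x p = eval x q) → I p = I q
  eq_zero : ∀ p, (∀ x ∈ stdSimplex ℝ ι, 0 ≤ eval x p) → I p = 0 →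
    ∀ x, (∀ j, 0 < x j) → ∑ j, x j = 1 → eval x p = 0
  rename_perm : ∀ (σ : Equiv.Perm ι) p, I (rename σ p) = I p

/-- Bernstein polynomials are nonnegative on the simplex and positive at the barycentre. The result
permits division by `I (bernPoly α)`. -/
theorem integral_bernPoly_ne_zero {I : MvPolynomial ι ℝ →ₗ[ℝ] ℝ} (hI : IsSimplexIntegral I)
    [Nonempty ι] (α : ι → ℕ) : I (bernPoly α) ≠ 0 := by
  intro h
  have hc : (0 : ℝ) < Fintype.card ι := by exact_mod_cast Fintype.card_pos
  refine (eval_bernPoly_pos α (x := fun _ => (Fintype.card ι : ℝ)⁻¹) fun j => by positivity).ne'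
    (hI.eq_zero _ (fun x hx => eval_bernPoly_nonneg α hx.1) h _ (fun j => by positivity) ?_)
  simp

variable [DecidableEq ι]

/-- This is the multinomial expansion of (Σ x_j)^k = 1. It is what allows the Bernstein polynomials
to serve as probability weights. -/
theorem sum_eval_bernPoly (k : ℕ) {x : ι → ℝ} (hx : ∑ j, x j = 1) :
    ∑ α ∈ Finset.univ.piAntidiag k, eval x (bernPoly α) = 1 := by
  have h := Finset.sum_pow_eq_sum_piAntidiag (Finset.univ : Finset ι) x k
  rw [hx, one_pow] at h
  rw [h]
  refine Finset.sum_congr rfl fun α hα => ?_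
  rw [eval_bernPoly]
  congr 1
  have hp : (∏ j, (Nat.factorial (α j) : ℝ)) ≠ 0 :=
    Finset.prod_ne_zero_iff.2 fun j _ => by exact_mod_cast Nat.factorial_ne_zero _
  rw [div_eq_iff hp, mul_comm]
  exact_mod_cast (Nat.multinomial_spec Finset.univ α).symm

/-- The Bernstein polynomials are linearly independent on the open reference simplex. -/
theorem eq_zero_of_sum_bernPoly_eq_zero [Nonempty ι] (k : ℕ) (y : (ι → ℕ) → ℝ)
    (h : ∀ x : ι → ℝ, (∀ j, 0 < x j) → ∑ j, x j = 1 →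
      ∑ α ∈ Finset.univ.piAntidiag k, y α * eval x (bernPoly α) = 0)
    {α : ι → ℕ} (hα : α ∈ Finset.univ.piAntidiag k) : y α = 0 := by
  set p : MvPolynomial ι ℝ := ∑ α ∈ Finset.univ.piAntidiag k, C (y α) * bernPoly α with hp
  -- `p` is homogeneous of degree `k`, so scaling by the coordinate sum carries its vanishing from
  -- the open simplex to the whole positive orthant, a product of infinite sets.
  have hp0 : p = 0 := by
    refine funext_set (fun _ => Ioi (0 : ℝ)) (fun _ => Ioi_infinite 0) fun x hx => ?_
    have hx' : ∀ j, 0 < x j := fun j => hx j (mem_univ j)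
    set s := ∑ j, x j with hs
    have hs0 : 0 < s := Finset.sum_pos (fun j _ => hx' j) Finset.univ_nonempty
    have h1 := h (fun j => x j / s) (fun j => div_pos (hx' j) hs0)
      (by rw [← Finset.sum_div, div_self hs0.ne'])
    rw [map_zero, hp, map_sum]
    have h2 : ∑ α ∈ Finset.univ.piAntidiag k, eval x (C (y α) * bernPoly α)
        = s ^ k * ∑ α ∈ Finset.univ.piAntidiag k,
          y α * eval (fun j => x j / s) (bernPoly α) := by
      rw [Finset.mul_sum]
      refine Finset.sum_congr rfl fun β hβ => ?_
      have hβ' : ∑ j, β j = k := (Finset.mem_piAntidiag.1 hβ).1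
      simp only [eval_bernPoly, map_mul, eval_C, div_pow, Finset.prod_div_distrib,
        Finset.prod_pow_eq_pow_sum, hβ']
      field_simp
    rw [h2, h1, mul_zero]
  have hc : coeff (Finsupp.equivFunOnFinite.symm α) p = 0 := by rw [hp0, coeff_zero]
  have hmon : ∀ β : ι → ℕ, bernPoly β = monomial (Finsupp.equivFunOnFinite.symm β)
      ((Nat.factorial (∑ j, β j) : ℝ) / ∏ j, (Nat.factorial (β j) : ℝ)) := by
    intro β
    rw [bernPoly, monomial_eq, Finsupp.prod_fintype _ _ (fun _ => pow_zero _)]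
    simp
  rw [hp, coeff_sum, Finset.sum_eq_single α] at hc
  · rw [hmon, coeff_C_mul, coeff_monomial, if_pos rfl] at hc
    have : (0 : ℝ) < ∏ j, (Nat.factorial (α j) : ℝ) :=
      Finset.prod_pos fun j _ => by exact_mod_cast Nat.factorial_pos _
    exact (mul_eq_zero.1 hc).resolve_right (by positivity)
  · intro β _ hβ
    rw [hmon, coeff_C_mul, coeff_monomial, if_neg (by simpa using hβ), mul_zero]
  · exact fun h => absurd hα h

/-- A functional is represented by a bilinear form if it vanishes on the isotropic vectors. -/
theorem exists_eq_of_forall_null {V : Type*} [AddCommGroup V] [Module ℝ V]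
    [FiniteDimensional ℝ V] (A : V →ₗ[ℝ] V →ₗ[ℝ] ℝ) 
    (F : V →ₗ[ℝ] ℝ) (hF : ∀ y, A y y = 0 → F y = 0) : ∃ x, A x = F := by
  -- In finite dimension the range of `A` is the annihilator of its coannihilator. A vector `y`
  -- there satisfies `A x y = 0` for every `x`, in particular for `x = y`.
  have hmem : F ∈ (LinearMap.range A).dualCoannihilator.dualAnnihilator := by
    rw [Submodule.mem_dualAnnihilator]
    intro y hy
    rw [Submodule.mem_dualCoannihilator] at hy
    exact hF y (hy _ ⟨y, rfl⟩)
  rwa [Subspace.dualCoannihilator_dualAnnihilator_eq] at hmem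

/-! ### The linear system for the local dual basis. -/

section Solve

variable (k : ℕ)

/-- The multi-indices of order `k` on `ι`. -/
abbrev MIdx (ι : Type*) [Fintype ι] [DecidableEq ι] (k : ℕ) :=
  {α : ι → ℕ // α ∈ Finset.univ.piAntidiag k}

/-- The rows of a coefficient matrix as polynomials. -/
def rowPoly : (MIdx ι k → MIdx ι k → ℝ) →ₗ[ℝ] (MIdx ι k → MvPolynomial ι ℝ) where
  toFun x α := ∑ β, x α β • bernPoly β.1
  map_add' x y := by ext1 α; simp [add_smul, Finset.sum_add_distrib]
  map_smul' c x := by ext1 α; simp [Finset.smul_sum, smul_smul]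

/-- The mean of a family of polynomials with respect to the Bernstein weights. -/
def bernMean : (MIdx ι k → MvPolynomial ι ℝ) →ₗ[ℝ] MvPolynomial ι ℝ where
  toFun q := ∑ α, bernPoly α.1 * q α
  map_add' x y := by simp only [Pi.add_apply, mul_add, Finset.sum_add_distrib]
  map_smul' c x := by
    simp only [Pi.smul_apply, mul_smul_comm, Finset.smul_sum, RingHom.id_apply]

/-- The deviation of the rows of a coefficient matrix from their mean. -/
def rowDev : (MIdx ι k → MIdx ι k → ℝ) →ₗ[ℝ] (MIdx ι k → MvPolynomial ι ℝ) where
  toFun x α := rowPoly k x α - bernMean k (rowPoly k x)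
  map_add' x y := by
    ext1 α
    simp only [map_add, Pi.add_apply]
    ring
  map_smul' c x := by
    ext1 α
    simp only [map_smul, Pi.smul_apply, smul_sub, RingHom.id_apply]

/-- The covariance form of two families of polynomials. -/
def covForm (I : MvPolynomial ι ℝ →ₗ[ℝ] ℝ) :
    (MIdx ι k → MIdx ι k → ℝ) →ₗ[ℝ] (MIdx ι k → MIdx ι k → ℝ) →ₗ[ℝ] ℝ :=
  LinearMap.mk₂ ℝ (fun x y => I (bernMean k (rowDev k x * rowPoly k y)))
    (fun x x' y => by rw [map_add, add_mul, map_add, map_add])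
    (fun c x y => by rw [map_smul, smul_mul_assoc, map_smul, map_smul])
    (fun x y y' => by rw [map_add, mul_add, map_add, map_add])
    (fun c x y => by rw [map_smul, mul_smul_comm, map_smul, map_smul])

/-- The right-hand side of the linear system for the dual basis. -/
def dualRhs (I : MvPolynomial ι ℝ →ₗ[ℝ] ℝ) : (MIdx ι k → MIdx ι k → ℝ) →ₗ[ℝ] ℝ where
  toFun y := ∑ α, I (bernPoly α.1) * y α α - I (bernMean k (rowPoly k y))
  map_add' x y := by simp only [map_add, Pi.add_apply, mul_add, Finset.sum_add_distrib]; ring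
  map_smul' c x := by
    simp only [map_smul, Pi.smul_apply, smul_eq_mul, RingHom.id_apply, mul_sub, Finset.mul_sum]
    congr 1
    exact Finset.sum_congr rfl fun _ _ => by ring

variable {k}

theorem eval_bernMean (q : MIdx ι k → MvPolynomial ι ℝ) (x : ι → ℝ) :
    eval x (bernMean k q) = ∑ α, eval x (bernPoly α.1) * eval x (q α) := by
  simp [bernMean]

theorem sum_eval_bernPoly_subtype {x : ι → ℝ} (hx : ∑ j, x j = 1) :
    ∑ α : MIdx ι k, eval x (bernPoly α.1) = 1 := by
  rw [Finset.sum_coe_sort (Finset.univ.piAntidiag k) fun α => eval x (bernPoly α),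
    sum_eval_bernPoly k hx]

variable {I : MvPolynomial ι ℝ →ₗ[ℝ] ℝ}

/-- Null vectors of the covariance form have equal rows. -/
theorem row_eq_of_covForm_eq_zero [Nonempty ι] (hI : IsSimplexIntegral I)
    (y : MIdx ι k → MIdx ι k → ℝ) (hy : covForm k I y y = 0) (α β : MIdx ι k) : y α = y β := by
  set q := rowPoly k y with hq
  set Q := bernMean k q with hQ
  -- The covariance of `y` with itself is a variance: the cross term is `Q` times the weighted sum
  -- of the deviations `q α - Q`, which is zero because the weights sum to 1.
  have hvar : I (∑ α, bernPoly α.1 * (q α - Q) ^ 2) = 0 := by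
    rw [← hy, covForm, LinearMap.mk₂_apply]
    refine hI.congr _ _ fun x hx => ?_
    have h1 := sum_eval_bernPoly_subtype (k := k) hx.2
    have h2 : eval x Q = ∑ α, eval x (bernPoly α.1) * eval x (q α) := eval_bernMean q x
    rw [eval_bernMean, ← sub_eq_zero, map_sum, ← Finset.sum_sub_distrib]
    simp only [Pi.mul_apply, rowDev, LinearMap.coe_mk, AddHom.coe_mk, map_mul, map_pow, map_sub]
    have h3 : ∀ α : MIdx ι k, eval x (bernPoly α.1) * (eval x (q α) - eval x Q) ^ 2
        - eval x (bernPoly α.1) * ((eval x (q α) - eval x Q) * eval x (q α))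
        = eval x Q * (eval x Q * eval x (bernPoly α.1)
          - eval x (bernPoly α.1) * eval x (q α)) := fun α => by ring
    rw [Finset.sum_congr rfl fun α _ => h3 α, ← Finset.mul_sum, Finset.sum_sub_distrib,
      ← Finset.mul_sum, h1, ← h2]
    ring
  have hzero := hI.eq_zero _ (fun x hx => by
    rw [map_sum]
    refine Finset.sum_nonneg fun α _ => ?_
    rw [map_mul, map_pow]
    exact mul_nonneg (eval_bernPoly_nonneg _ hx.1) (sq_nonneg _)) hvar
  -- A vanishing sum of nonnegative terms vanishes termwise, and all weights are positive in the
  -- open simplex.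
  have hrow : ∀ α, ∀ x : ι → ℝ, (∀ j, 0 < x j) → ∑ j, x j = 1 → eval x (q α) = eval x Q := by
    intro α x hx hx1
    have h := hzero x hx hx1
    rw [map_sum, Finset.sum_eq_zero_iff_of_nonneg (fun α _ => by
      rw [map_mul, map_pow]
      exact mul_nonneg (eval_bernPoly_pos _ hx).le (sq_nonneg _))] at h
    have := h α (Finset.mem_univ _)
    rw [map_mul, map_pow, mul_eq_zero, or_iff_right (eval_bernPoly_pos _ hx).ne', sq_eq_zero_iff,
      map_sub, sub_eq_zero] at this
    exact this
  ext γ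
  rw [← sub_eq_zero]
  have := eq_zero_of_sum_bernPoly_eq_zero k
    (fun γ => if h : γ ∈ Finset.univ.piAntidiag k then y α ⟨γ, h⟩ - y β ⟨γ, h⟩ else 0)
    (fun x hx hx1 => by
      have e := (hrow α x hx hx1).trans (hrow β x hx hx1).symm
      rw [← sub_eq_zero, hq] at e
      simp only [rowPoly, LinearMap.coe_mk, AddHom.coe_mk, map_sum, smul_eval] at e
      rw [← Finset.sum_sub_distrib] at e
      rw [← e, ← Finset.sum_coe_sort]
      refine Finset.sum_congr rfl fun γ _ => ?_
      rw [dif_pos γ.2]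
      ring) γ.2
  simpa only [dif_pos γ.2] using this

/-- For equal rows both terms of the right-hand side are the integral of the common row polynomial:
the diagonal entries are its coefficients, and its weighted mean is itself. -/
theorem dualRhs_eq_zero [Nonempty ι] (hI : IsSimplexIntegral I)
    (y : MIdx ι k → MIdx ι k → ℝ) (hy : covForm k I y y = 0) : dualRhs k I y = 0 := by
  have hrow := row_eq_of_covForm_eq_zero hI y hy
  simp only [dualRhs, LinearMap.coe_mk, AddHom.coe_mk]
  rw [sub_eq_zero]
  have : ∑ α, I (bernPoly α.1) * y α α = I (∑ α : MIdx ι k, y α α • bernPoly α.1) := by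
    simp [mul_comm]
  rw [this]
  refine hI.congr _ _ fun x hx => ?_
  have h1 := sum_eval_bernPoly_subtype (k := k) hx.2
  have h2 : ∀ α, eval x (rowPoly k y α) = ∑ β : MIdx ι k, y β β * eval x (bernPoly β.1) := by
    intro α
    simp only [rowPoly, LinearMap.coe_mk, AddHom.coe_mk, map_sum, smul_eval]
    exact Finset.sum_congr rfl fun β _ => by rw [hrow α β]
  rw [eval_bernMean]
  simp only [h2]
  rw [← Finset.sum_mul, h1, one_mul]
  simp [smul_eval]

theorem totalDegree_rowPoly_le (x : MIdx ι k → MIdx ι k → ℝ) (α : MIdx ι k) :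
    (rowPoly k x α).totalDegree ≤ k := by
  refine (totalDegree_finsetSum_le fun β _ => ?_)
  refine (totalDegree_smul_le _ _).trans ((totalDegree_bernPoly_le _).trans ?_)
  exact (Finset.mem_piAntidiag.1 β.2).1.le

/-- Existence of the local dual basis, without symmetry. -/
theorem exists_local_dual (hI : IsSimplexIntegral I) [Nonempty ι] (k : ℕ) :
    ∃ Z : (ι → ℕ) → MvPolynomial ι ℝ,
      (∀ α, (Z α).totalDegree ≤ 2 * k) ∧
      (∀ α ∈ Finset.univ.piAntidiag k, ∀ β ∈ Finset.univ.piAntidiag k,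
        I (bernPoly β * (bernPoly α * Z α)) = if α = β then 1 else 0) ∧
      (∀ x ∈ stdSimplex ℝ ι, ∑ α ∈ Finset.univ.piAntidiag k,
        I (bernPoly α) * (eval x (bernPoly α) * eval x (Z α)) = 1) := by
  obtain ⟨x, hx⟩ := exists_eq_of_forall_null (covForm k I) (dualRhs k I) (dualRhs_eq_zero hI)
  set q := rowPoly k x with hq
  set Q := bernMean k q with hQ
  -- Subtracting the mean makes the mass identity automatic; the summand 1 supplies its right-hand
  -- side. The degree 2k comes from `Q`.
  let Z : (ι → ℕ) → MvPolynomial ι ℝ := fun α =>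
    if h : α ∈ Finset.univ.piAntidiag k then C (I (bernPoly α))⁻¹ * (q ⟨α, h⟩ - Q + 1) else 0
  have hZ : ∀ α : MIdx ι k, Z α.1 = C (I (bernPoly α.1))⁻¹ * (q α - Q + 1) := fun α =>
    dif_pos α.2
  have hQd : Q.totalDegree ≤ 2 * k := by
    refine totalDegree_finsetSum_le fun α _ => (totalDegree_mul _ _).trans ?_
    have h1 := (totalDegree_bernPoly_le α.1).trans (Finset.mem_piAntidiag.1 α.2).1.le
    have h2 := totalDegree_rowPoly_le x α
    rw [← hq] at h2
    omega
  refine ⟨Z, fun α => ?_, fun α hα β hβ => ?_, fun z hz => ?_⟩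
  · by_cases h : α ∈ Finset.univ.piAntidiag k
    · rw [hZ ⟨α, h⟩]
      refine (totalDegree_mul _ _).trans ?_
      rw [totalDegree_C, zero_add]
      refine (totalDegree_add _ _).trans (max_le ((totalDegree_sub _ _).trans (max_le ?_ hQd)) ?_)
      · have h2 := totalDegree_rowPoly_le x ⟨α, h⟩
        rw [← hq] at h2
        omega
      · simp
    · simp only [Z, dif_neg h, totalDegree_zero, zero_le]
  · have hc := integral_bernPoly_ne_zero hI α
    -- Testing the system with the elementary matrix at `(α, β)` isolates one biorthogonality
    -- relation.
    have key := LinearMap.congr_fun hx (Pi.single ⟨α, hα⟩ (Pi.single ⟨β, hβ⟩ 1))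
    have hrow : rowPoly k (Pi.single (⟨α, hα⟩ : MIdx ι k) (Pi.single (⟨β, hβ⟩ : MIdx ι k) (1 : ℝ)))
        = Pi.single ⟨α, hα⟩ (bernPoly β) := by
      ext1 γ
      simp only [rowPoly, LinearMap.coe_mk, AddHom.coe_mk]
      by_cases hγ : γ = ⟨α, hα⟩
      · subst hγ
        simp [Pi.single_apply]
      · simp [hγ]
    have hmean : ∀ r : MIdx ι k → MvPolynomial ι ℝ,
        bernMean k (r * (Pi.single ⟨α, hα⟩ (bernPoly β) : MIdx ι k → _))
        = bernPoly α * (r ⟨α, hα⟩ * bernPoly β) := by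
      intro r
      simp only [bernMean, LinearMap.coe_mk, AddHom.coe_mk]
      rw [Finset.sum_eq_single ⟨α, hα⟩]
      · simp
      · intro γ _ hγ; simp [hγ]
      · simp
    have hmean1 := hmean 1
    simp only [one_mul, Pi.one_apply] at hmean1
    simp only [covForm, LinearMap.mk₂_apply, dualRhs, LinearMap.coe_mk, AddHom.coe_mk, hrow] at key
    rw [hmean, hmean1] at key
    have hsum : ∑ γ : MIdx ι k, I (bernPoly γ.1) *
        (Pi.single (⟨α, hα⟩ : MIdx ι k) (Pi.single (⟨β, hβ⟩ : MIdx ι k) (1 : ℝ)) :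
          MIdx ι k → MIdx ι k → ℝ) γ γ = if α = β then I (bernPoly α) else 0 := by
      rw [Finset.sum_eq_single ⟨α, hα⟩]
      · simp [Pi.single_apply]
      · intro γ _ hγ; simp [hγ]
      · simp
    rw [hsum] at key
    change I (bernPoly α * ((q ⟨α, hα⟩ - Q) * bernPoly β)) = _ at key
    rw [hZ ⟨α, hα⟩]
    have e : bernPoly β * (bernPoly α * (C (I (bernPoly α))⁻¹ * (q ⟨α, hα⟩ - Q + 1)))
        = (I (bernPoly α))⁻¹ •
          (bernPoly α * ((q ⟨α, hα⟩ - Q) * bernPoly β) + bernPoly α * bernPoly β) := by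
      rw [smul_eq_C_mul]; ring
    rw [e, map_smul, map_add, key]
    split_ifs
    · simp [hc]
    · simp
  · have h1 := sum_eval_bernPoly_subtype (k := k) hz.2
    rw [← Finset.sum_coe_sort]
    have h3 : ∀ α : MIdx ι k, I (bernPoly α.1) * (eval z (bernPoly α.1) * eval z (Z α.1))
        = eval z (bernPoly α.1) * eval z (q α) - eval z (bernPoly α.1) * eval z Q
          + eval z (bernPoly α.1) := by
      intro α
      have hc := integral_bernPoly_ne_zero hI α.1
      rw [hZ]
      simp only [map_mul, map_add, map_sub, eval_C, map_one]
      field_simp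
    rw [Finset.sum_congr rfl fun α _ => h3 α, Finset.sum_add_distrib, Finset.sum_sub_distrib,
      ← Finset.sum_mul, h1, ← eval_bernMean]
    ring

/-- Existence of the local dual basis, equivariant under permutations of the vertices. -/
theorem exists_equivariant_local_dual (hI : IsSimplexIntegral I) [Nonempty ι] (k : ℕ) :
    ∃ Z : (ι → ℕ) → MvPolynomial ι ℝ,
      (∀ α, (Z α).totalDegree ≤ 2 * k) ∧
      (∀ (σ : Equiv.Perm ι) α x, eval (x ∘ σ) (Z (α ∘ σ)) = eval x (Z α)) ∧
      (∀ α ∈ Finset.univ.piAntidiag k, ∀ β ∈ Finset.univ.piAntidiag k,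
        I (bernPoly β * (bernPoly α * Z α)) = if α = β then 1 else 0) ∧
      (∀ x ∈ stdSimplex ℝ ι, ∑ α ∈ Finset.univ.piAntidiag k,
        I (bernPoly α) * (eval x (bernPoly α) * eval x (Z α)) = 1) := by
  obtain ⟨Z, hdeg, hdual, hmass⟩ := exists_local_dual hI k
  have hcomp : ∀ (σ : Equiv.Perm ι) (α : ι → ℕ),
      α ∘ σ ∈ Finset.univ.piAntidiag k ↔ α ∈ Finset.univ.piAntidiag k := by
    intro σ α
    simp only [Finset.mem_piAntidiag, Finset.mem_univ, implies_true, and_true, Function.comp_apply]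
    rw [Equiv.sum_comp σ α]
  set c : ℝ := (Fintype.card (Equiv.Perm ι) : ℝ)⁻¹ with hc
  have hc1 : ∑ _σ : Equiv.Perm ι, c = 1 := by
    rw [Finset.sum_const, Finset.card_univ, nsmul_eq_mul, hc, mul_inv_cancel₀]
    exact_mod_cast Fintype.card_ne_zero
  refine ⟨fun α => ∑ σ : Equiv.Perm ι, c • rename σ (Z (α ∘ σ)), fun α => ?_, fun τ α x => ?_,
    fun α hα β hβ => ?_, fun x hx => ?_⟩
  · refine totalDegree_finsetSum_le fun σ _ => (totalDegree_smul_le _ _).trans ?_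
    exact (totalDegree_rename_le _ _).trans (hdeg _)
  -- Composition with `τ` only permutes the terms of the average.
  · simp only [map_sum, smul_eval, eval_rename]
    rw [← Equiv.sum_comp (Equiv.mulLeft τ) fun σ => c * eval (x ∘ σ) (Z (α ∘ σ))]
    rfl
  · have h1 : bernPoly β * (bernPoly α * ∑ σ : Equiv.Perm ι, c • rename σ (Z (α ∘ σ)))
        = ∑ σ : Equiv.Perm ι, c • rename σ
          (bernPoly (β ∘ σ) * (bernPoly (α ∘ σ) * Z (α ∘ σ))) := by
      simp only [map_mul, rename_perm_bernPoly, Finset.mul_sum, mul_smul_comm]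
    rw [h1, map_sum]
    have h2 : ∀ σ : Equiv.Perm ι,
        I (c • rename σ (bernPoly (β ∘ σ) * (bernPoly (α ∘ σ) * Z (α ∘ σ))))
        = c * if α = β then 1 else 0 := by
      intro σ
      rw [map_smul, hI.rename_perm, hdual _ ((hcomp σ α).2 hα) _ ((hcomp σ β).2 hβ), smul_eq_mul]
      congr 1
      simp only [σ.surjective.injective_comp_right.eq_iff]
    rw [Finset.sum_congr rfl fun σ _ => h2 σ, ← Finset.sum_mul, hc1, one_mul]
  · have h1 : ∀ σ : Equiv.Perm ι, ∑ α ∈ Finset.univ.piAntidiag k,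
        I (bernPoly α) * (eval x (bernPoly α) * eval (x ∘ σ) (Z (α ∘ σ))) = 1 := by
      intro σ
      rw [← hmass (x ∘ σ) ⟨fun j => hx.1 (σ j), by
        simp only [Function.comp_apply]; rw [Equiv.sum_comp σ x, hx.2]⟩]
      refine Finset.sum_bij (fun α _ => α ∘ σ) (fun α hα => (hcomp σ α).2 hα)
        (fun α _ β _ h => σ.surjective.injective_comp_right h)
        (fun β hβ => ⟨β ∘ σ.symm, (hcomp σ.symm β).2 hβ, by ext; simp⟩) fun α _ => ?_
      rw [eval_bernPoly_comp_perm, ← hI.rename_perm σ (bernPoly (α ∘ σ)), rename_perm_bernPoly]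
    have h2 : ∀ α : ι → ℕ, I (bernPoly α) * (eval x (bernPoly α) *
        eval x (∑ σ : Equiv.Perm ι, c • rename σ (Z (α ∘ σ))))
        = ∑ σ : Equiv.Perm ι, c *
          (I (bernPoly α) * (eval x (bernPoly α) * eval (x ∘ σ) (Z (α ∘ σ)))) := by
      intro α
      simp only [map_sum, smul_eval, eval_rename, Finset.mul_sum]
      exact Finset.sum_congr rfl fun σ _ => by ring
    rw [Finset.sum_congr rfl fun α _ => h2 α, Finset.sum_comm]
    simp only [← Finset.mul_sum, h1, mul_one]
    exact hc1

end Solve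

end Reference

/-! ### Integration in barycentric coordinates -/

section SimplexIntegral

variable {d : ℕ} {ι : Type*} [Fintype ι]

theorem coords_mem_stdSimplex (b : AffineBasis ι ℝ (Eu d)) {x : Eu d}
    (hx : x ∈ convexHull ℝ (range b)) : b.coords x ∈ stdSimplex ℝ ι := by
  rw [b.convexHull_eq_nonneg_coord] at hx
  exact ⟨fun j => hx j, b.sum_coord_apply_eq_one x⟩

theorem continuous_coords (b : AffineBasis ι ℝ (Eu d)) : Continuous b.coords :=
  AffineMap.continuous_of_finiteDimensional _

theorem isCompact_hull (b : AffineBasis ι ℝ (Eu d)) : IsCompact (convexHull ℝ (range b)) :=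
  (finite_range b).isCompact_convexHull ℝ

theorem hull_volume_pos (b : AffineBasis ι ℝ (Eu d)) :
    0 < volume.real (convexHull ℝ (range b)) := by
  refine ENNReal.toReal_pos (ne_of_gt ?_) (isCompact_hull b).measure_ne_top
  exact Measure.measure_pos_of_nonempty_interior _
    (interior_convexHull_nonempty_iff_affineSpan_eq_top.2 b.tot)

/-- The affine change of coordinates between two simplices scales integrals by the ratio of the
volumes. -/
theorem integral_hull_comp_coords (b₀ b : AffineBasis ι ℝ (Eu d)) (F : (ι → ℝ) → ℝ) :
    ∫ x in convexHull ℝ (range b), F (b.coords x) =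
      volume.real (convexHull ℝ (range b)) * ((volume.real (convexHull ℝ (range b₀)))⁻¹ *
        ∫ x in convexHull ℝ (range b₀), F (b₀.coords x)) := by
  classical
  obtain ⟨j₀⟩ := b₀.nonempty
  let L : Eu d ≃ₗ[ℝ] Eu d := (b₀.basisOf j₀).equiv (b.basisOf j₀) (Equiv.refl _)
  let A : Eu d ≃ᵃ[ℝ] Eu d :=
    ((AffineEquiv.constVAdd ℝ (Eu d) (-b₀ j₀)).trans L.toAffineEquiv).trans
      (AffineEquiv.constVAdd ℝ (Eu d) (b j₀))
  have hA : ∀ x, A x = b j₀ + L (-b₀ j₀ + x) := fun x => rfl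
  have hAb : ∀ j, A (b₀ j) = b j := by
    intro j
    by_cases hj : j = j₀
    · subst hj; simp [hA]
    · have h1 : -b₀ j₀ + b₀ j = b₀.basisOf j₀ ⟨j, hj⟩ := by
        rw [AffineBasis.basisOf_apply, vsub_eq_sub]; abel
      have h2 : L (b₀.basisOf j₀ ⟨j, hj⟩) = b.basisOf j₀ ⟨j, hj⟩ :=
        (b₀.basisOf j₀).equiv_apply _ _ _
      rw [hA, h1, h2, AffineBasis.basisOf_apply, vsub_eq_sub]
      abel
  have hcoord : ∀ x, b.coords (A x) = b₀.coords x := by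
    intro x
    ext j
    rw [AffineBasis.coords_apply, AffineBasis.coords_apply]
    conv_lhs => rw [← b₀.affineCombination_coord_eq_self x]
    have := Finset.map_affineCombination Finset.univ b₀ (fun j => b₀.coord j x)
      (b₀.sum_coord_apply_eq_one x) A.toAffineMap
    rw [← AffineEquiv.coe_toAffineMap, this]
    have e : (A.toAffineMap ∘ b₀ : ι → Eu d) = b := funext hAb
    rw [e]
    exact b.coord_apply_combination_of_mem (Finset.mem_univ j) (b₀.sum_coord_apply_eq_one x)
  have hpre : A ⁻¹' convexHull ℝ (range b) = convexHull ℝ (range b₀) := by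
    ext x
    rw [mem_preimage, b.convexHull_eq_nonneg_coord, b₀.convexHull_eq_nonneg_coord]
    simp only [mem_ofPred_eq, ← AffineBasis.coords_apply, hcoord]
  have hAm : MeasurableEmbedding A :=
    (AffineEquiv.toContinuousAffineEquiv A).toHomeomorph.measurableEmbedding
  -- An affine bijection scales Lebesgue measure by a constant. Its value is not needed: the choice
  -- `G = 1` below identifies it through the two volumes.
  obtain ⟨c, hc⟩ : ∃ c : ℝ≥0∞, Measure.map A (volume : Measure (Eu d)) = c • volume := by
    refine ⟨ENNReal.ofReal |(LinearMap.det (L : Eu d →ₗ[ℝ] Eu d))⁻¹|, ?_⟩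
    have hdet : LinearMap.det (L : Eu d →ₗ[ℝ] Eu d) ≠ 0 := L.isUnit_det'.ne_zero
    have h1 : (A : Eu d → Eu d) = (fun y => b j₀ + y) ∘ (L : Eu d →ₗ[ℝ] Eu d) ∘
      (fun x => -b₀ j₀ + x) := rfl
    have hL : Measurable (L : Eu d →ₗ[ℝ] Eu d) :=
      (LinearMap.continuous_of_finiteDimensional _).measurable
    rw [h1, ← Measure.map_map (measurable_const_add _) (hL.comp (measurable_const_add _)),
      ← Measure.map_map hL (measurable_const_add _),
      map_add_left_eq_self volume (-b₀ j₀),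
      Measure.map_linearMap_addHaar_eq_smul_addHaar volume hdet, Measure.map_smul,
      map_add_left_eq_self]
  have key : ∀ G : (ι → ℝ) → ℝ, c.toReal * ∫ x in convexHull ℝ (range b), G (b.coords x) =
      ∫ x in convexHull ℝ (range b₀), G (b₀.coords x) := by
    intro G
    have := hAm.setIntegral_map (μ := volume) (fun x => G (b.coords x)) (convexHull ℝ (range b))
    rw [hc, Measure.restrict_smul, integral_smul_measure, hpre] at this
    simpa only [hcoord, smul_eq_mul] using this
  have h1 := key fun _ => 1
  simp only [setIntegral_const, smul_eq_mul, mul_one] at h1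
  have hp := hull_volume_pos b₀
  rw [← key F, ← h1]
  rw [← h1] at hp
  have hc0 : c.toReal ≠ 0 := (pos_of_mul_pos_left hp (hull_volume_pos b).le).ne'
  have hb0 := (hull_volume_pos b).ne'
  field_simp

/-- A chosen reference simplex. -/
def refBasis (d : ℕ) : AffineBasis (Fin (d + 1)) ℝ (Eu d) :=
  (AffineBasis.exists_affineBasis_of_finiteDimensional (by simp)).some

theorem continuous_eval_coords (b : AffineBasis ι ℝ (Eu d)) (p : MvPolynomial ι ℝ) :
    Continuous fun x => MvPolynomial.eval (b.coords x) p :=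
  (MvPolynomial.continuous_eval p).comp (continuous_coords b)

theorem integrableOn_eval_coords (b : AffineBasis ι ℝ (Eu d)) (p : MvPolynomial ι ℝ) :
    IntegrableOn (fun x => MvPolynomial.eval (b.coords x) p) (convexHull ℝ (range b)) :=
  (continuous_eval_coords b p).continuousOn.integrableOn_compact (isCompact_hull b)

/-- The normalized integral over the reference simplex of a polynomial in barycentric
coordinates. -/
def refIntegral (d : ℕ) : MvPolynomial (Fin (d + 1)) ℝ →ₗ[ℝ] ℝ where
  toFun p := (volume.real (convexHull ℝ (range (refBasis d))))⁻¹ *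
    ∫ x in convexHull ℝ (range (refBasis d)), MvPolynomial.eval ((refBasis d).coords x) p
  map_add' p q := by
    simp only [map_add]
    rw [integral_add (integrableOn_eval_coords _ p) (integrableOn_eval_coords _ q), mul_add]
  map_smul' c p := by
    simp only [MvPolynomial.smul_eval, RingHom.id_apply, smul_eq_mul]
    rw [integral_const_mul]
    ring

theorem integral_hull_eval_coords (b : AffineBasis (Fin (d + 1)) ℝ (Eu d))
    (p : MvPolynomial (Fin (d + 1)) ℝ) :
    ∫ x in convexHull ℝ (range b), MvPolynomial.eval (b.coords x) p =
      volume.real (convexHull ℝ (range b)) * refIntegral d p :=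
  integral_hull_comp_coords (refBasis d) b fun y => MvPolynomial.eval y p

/-- Null integral of a nonnegative continuous function forces it to vanish on the interior, where
all coordinates are positive. Permuting the vertices leaves the simplex, hence its volume,
unchanged, which gives the symmetry. -/
theorem isSimplexIntegral_refIntegral (d : ℕ) : IsSimplexIntegral (refIntegral d) where
  congr p q h := by
    simp only [refIntegral, LinearMap.coe_mk, AddHom.coe_mk]
    congr 1
    exact setIntegral_congr_fun (isCompact_hull _).measurableSet fun x hx =>
      h _ (coords_mem_stdSimplex _ hx)
  eq_zero p hp h x hx hx1 := by
    set b := refBasis d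
    have hv := (hull_volume_pos b).ne'
    have h0 : ∫ x in convexHull ℝ (range b), MvPolynomial.eval (b.coords x) p = 0 :=
      (mul_eq_zero.1 h).resolve_left (inv_ne_zero hv)
    rw [setIntegral_eq_zero_iff_of_nonneg_ae
      ((ae_restrict_iff' (isCompact_hull b).measurableSet).2
        (ae_of_all _ fun y hy => hp _ (coords_mem_stdSimplex b hy)))
      (integrableOn_eval_coords b p)] at h0
    have h1 := Measure.eqOn_open_of_ae_eq (ae_restrict_of_ae_restrict_of_subset interior_subset h0)
      isOpen_interior (continuous_eval_coords b p).continuousOn continuousOn_const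
    have hy : b.coords (Finset.univ.affineCombination ℝ b x) = x := by
      ext j
      exact b.coord_apply_combination_of_mem (Finset.mem_univ j) hx1
    have hmem : Finset.univ.affineCombination ℝ b x ∈ interior (convexHull ℝ (range b)) := by
      rw [b.interior_convexHull]
      intro j
      rw [← AffineBasis.coords_apply, hy]
      exact hx j
    simpa only [hy, Pi.zero_apply] using h1 hmem
  rename_perm σ p := by
    have h := integral_hull_eval_coords ((refBasis d).reindex σ.symm) p
    have hr : range ((refBasis d).reindex σ.symm) = range (refBasis d) := by
      rw [AffineBasis.coe_reindex]
      exact σ.symm.symm.surjective.range_comp _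
    have hco : ∀ x, ((refBasis d).reindex σ.symm).coords x = (refBasis d).coords x ∘ σ := by
      intro x
      ext j
      simp
    simp only [hr, hco, ← MvPolynomial.eval_rename] at h
    rw [refIntegral, LinearMap.coe_mk, AddHom.coe_mk, h, inv_mul_cancel_left₀]
    · rfl
    · exact (hull_volume_pos _).ne'

end SimplexIntegral

/-! ### Piecewise polynomials are Sobolev functions -/

section Piecewise

open scoped NNReal

variable {d : ℕ}

theorem contDiff_eval_mvPolynomial (p : MvPolynomial (Fin d) ℝ) :
    ContDiff ℝ 1 fun x : Eu d => MvPolynomial.eval (fun j => x j) p := by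
  induction p using MvPolynomial.induction_on with
  | C a => simpa using contDiff_const
  | add p q hp hq => simpa using hp.add hq
  | mul_X p j hp =>
    simp only [map_mul, MvPolynomial.eval_X]
    exact hp.mul (by fun_prop)

theorem isCompact_simplex (T : Finset (Eu d)) : IsCompact (simplex T) :=
  T.finite_toSet.isCompact_convexHull ℝ

theorem convex_simplex (T : Finset (Eu d)) : Convex ℝ (simplex T) := convex_convexHull ℝ _

theorem IsPolyOn.continuousOn {m : ℕ} {S : Set (Eu d)} {f : Eu d → ℝ} (hf : IsPolyOn m S f) :
    ContinuousOn f S := by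
  obtain ⟨p, -, hp⟩ := hf
  exact (contDiff_eval_mvPolynomial p).continuous.continuousOn.congr hp

theorem IsPolyOn.exists_lipschitzOnWith {m : ℕ} {S : Set (Eu d)} {f : Eu d → ℝ}
    (hf : IsPolyOn m S f) (hS : IsCompact S) : ∃ K, LipschitzOnWith K f S := by
  obtain ⟨p, -, hp⟩ := hf
  obtain ⟨K, hK⟩ := LocallyLipschitzOn.exists_lipschitzOnWith_of_compact hS
    ((contDiff_eval_mvPolynomial p).locallyLipschitz.locallyLipschitzOn)
  exact ⟨K, fun x hx y hy => by rw [hp x hx, hp y hy]; exact hK hx hy⟩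

variable {C : Finset (Finset (Eu d))} {f : Eu d → ℝ} {m : ℕ}

theorem isCompact_biUnion_simplex (C : Finset (Finset (Eu d))) :
    IsCompact (⋃ T ∈ C, simplex T) :=
  C.isCompact_biUnion fun T _ => isCompact_simplex T

theorem continuousOn_biUnion_simplex (hf : ∀ T ∈ C, IsPolyOn m (simplex T) f) :
    ContinuousOn f (⋃ T ∈ C, simplex T) := by
  have : (⋃ T ∈ C, simplex T) = ⋃ T : C, simplex T.1 := by
    rw [iUnion_subtype]
  rw [this]
  exact (locallyFinite_of_finite _).continuousOn_iUnion
    (fun T => (isCompact_simplex T.1).isClosed) fun T => (hf T.1 T.2).continuousOn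

theorem exists_lipschitzOnWith_simplex (hf : ∀ T ∈ C, IsPolyOn m (simplex T) f) :
    ∃ K, ∀ T ∈ C, LipschitzOnWith K f (simplex T) := by
  choose! K hK using fun T hT => (hf T hT).exists_lipschitzOnWith (isCompact_simplex T)
  exact ⟨C.sup K, fun T hT => (hK T hT).weaken (Finset.le_sup hT)⟩

/-- A function on an interval that is continuous, and Lipschitz on each of finitely many closed
sets that cover the interval, satisfies the Lipschitz estimate. -/
theorem abs_sub_le_of_finite_cover {ι : Type*} (s : Finset ι) (S : ι → Set ℝ) {h : ℝ → ℝ} {K : ℝ}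
    (hS : ∀ i ∈ s, IsClosed (S i)) (hcov : Icc (0 : ℝ) 1 ⊆ ⋃ i ∈ s, S i)
    (hc : ContinuousOn h (Icc 0 1))
    (hK : ∀ i ∈ s, ∀ t ∈ S i ∩ Icc 0 1, ∀ u ∈ S i ∩ Icc 0 1, |h t - h u| ≤ K * |t - u|) :
    |h 1 - h 0| ≤ K := by
  have hsub : Icc (0 : ℝ) 1 ⊆ {t | |h t - h 0| ≤ K * t} := by
    -- Continuous induction on the interval: the set of good `t` is closed, and from each good `t <
    -- 1` one can move to the right.
    refine IsClosed.Icc_subset_of_forall_exists_gt ?_ (by simp) ?_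
    · have hcl : ContinuousOn (fun t => |h t - h 0| - K * t) (Icc 0 1) := by fun_prop
      have := hcl.preimage_isClosed_of_isClosed isClosed_Icc (isClosed_Iic (a := (0 : ℝ)))
      convert this using 1
      ext t
      simp [and_comm]
    · rintro t ⟨ht, ht0, ht1⟩ y hy
      -- One of the finitely many sets accumulates at `t` from the right; being closed it contains
      -- `t`, so its Lipschitz bound applies from `t` onwards.
      obtain ⟨i, hi, hfr⟩ : ∃ i ∈ s, ∃ᶠ u in 𝓝[>] t, u ∈ S i := by
        by_contra! hcon
        have h1 : ∀ᶠ u in 𝓝[>] t, ∀ i ∈ s, u ∉ S i :=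
          (Filter.eventually_all_finset s).2 fun i hi => hcon i hi
        have h2 : ∀ᶠ u in 𝓝[>] t, u ∈ Ioo t 1 := Ioo_mem_nhdsGT ht1
        obtain ⟨u, hu1, hu2⟩ := (h1.and h2).exists
        obtain ⟨i, hi, hui⟩ := mem_iUnion₂.1 (hcov ⟨ht0.trans hu2.1.le, hu2.2.le⟩)
        exact hu1 i hi hui
      have htS : t ∈ S i := by
        refine (hS i hi).closure_subset (mem_closure_iff_frequently.2 ?_)
        exact hfr.filter_mono nhdsWithin_le_nhds
      have h2 : ∀ᶠ u in 𝓝[>] t, u ∈ Ioo t (min y 1) := Ioo_mem_nhdsGT (lt_min hy ht1)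
      obtain ⟨u, huS, hu⟩ := (hfr.and_eventually h2).exists
      have hu1 : u ≤ 1 := hu.2.le.trans (min_le_right _ _)
      refine ⟨u, ?_, hu.1, hu.2.le.trans (min_le_left _ _)⟩
      have h3 := hK i hi u ⟨huS, ht0.trans hu.1.le, hu1⟩ t ⟨htS, ht0, ht1.le⟩
      rw [abs_of_pos (sub_pos.2 hu.1)] at h3
      have h4 : |h t - h 0| ≤ K * t := ht
      change |h u - h 0| ≤ K * u
      calc |h u - h 0| ≤ |h u - h t| + |h t - h 0| := abs_sub_le _ _ _
        _ ≤ K * (u - t) + K * t := add_le_add h3 h4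
        _ = K * u := by ring
  simpa using hsub (right_mem_Icc.2 zero_le_one)

/-- A function that is Lipschitz on each simplex is Lipschitz on convex subsets of the union. -/
theorem lipschitzOnWith_of_convex (hf : ∀ T ∈ C, IsPolyOn m (simplex T) f) {K : ℝ≥0}
    (hK : ∀ T ∈ C, LipschitzOnWith K f (simplex T)) {B : Set (Eu d)} (hB : Convex ℝ B)
    (hBC : B ⊆ ⋃ T ∈ C, simplex T) : LipschitzOnWith K f B := by
  refine LipschitzOnWith.of_dist_le_mul fun y hy x hx => ?_
  let c : ℝ → Eu d := AffineMap.lineMap x y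
  have hc : Continuous c := AffineMap.lineMap_continuous
  have hcB : ∀ t ∈ Icc (0 : ℝ) 1, c t ∈ B := fun t ht => hB.lineMap_mem hx hy ht
  have key := abs_sub_le_of_finite_cover C (fun T => c ⁻¹' simplex T) (h := f ∘ c)
    (K := K * dist y x) (fun T _ => (isCompact_simplex T).isClosed.preimage hc)
    (fun t ht => by simpa using hBC (hcB t ht))
    (((continuousOn_biUnion_simplex hf).mono hBC).comp hc.continuousOn hcB)
    (fun T hT t ht u hu => by
      have := (hK T hT).dist_le_mul _ ht.1 _ hu.1
      rw [dist_lineMap_lineMap, Real.dist_eq, Real.dist_eq] at this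
      rw [dist_comm y x]
      calc _ ≤ _ := this
        _ = _ := by ring)
  simpa [c, Real.dist_eq] using key

variable {U : Set (Eu d)}

/-- A ball is convex, so the Lipschitz bounds of the pieces combine on it. Where `f` is not
differentiable, `fderiv` is 0, so no exceptional set arises. -/
theorem norm_fderiv_le_of_piecewise (hU : IsOpen U) (hUC : U ⊆ ⋃ T ∈ C, simplex T)
    (hf : ∀ T ∈ C, IsPolyOn m (simplex T) f) {K : ℝ≥0}
    (hK : ∀ T ∈ C, LipschitzOnWith K f (simplex T)) {x : Eu d} (hx : x ∈ U) :
    ‖fderiv ℝ f x‖ ≤ K := by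
  obtain ⟨r, hr, hrU⟩ := Metric.isOpen_iff.1 hU x hx
  exact norm_fderiv_le_of_lipschitzOn ℝ (Metric.ball_mem_nhds x hr)
    (lipschitzOnWith_of_convex hf hK (convex_ball x r) (hrU.trans hUC))

theorem norm_gradient (f : Eu d → ℝ) (x : Eu d) : ‖gradient f x‖ = ‖fderiv ℝ f x‖ := by
  rw [gradient, LinearIsometryEquiv.norm_map]

theorem measurable_gradient (f : Eu d → ℝ) : Measurable (gradient f) :=
  (LinearIsometryEquiv.continuous _).measurable.comp (measurable_fderiv ℝ f)

theorem integrableOn_of_piecewise (hUC : U ⊆ ⋃ T ∈ C, simplex T)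
    (hf : ∀ T ∈ C, IsPolyOn m (simplex T) f) : IntegrableOn f U :=
  ((continuousOn_biUnion_simplex hf).integrableOn_compact (isCompact_biUnion_simplex C)).mono_set
    hUC

theorem integrableOn_gradient_of_piecewise (hU : IsOpen U) (hUC : U ⊆ ⋃ T ∈ C, simplex T)
    (hf : ∀ T ∈ C, IsPolyOn m (simplex T) f) : IntegrableOn (gradient f) U := by
  obtain ⟨K, hK⟩ := exists_lipschitzOnWith_simplex hf
  have hfin : volume U ≠ ⊤ :=
    ((measure_mono hUC).trans_lt (isCompact_biUnion_simplex C).measure_lt_top).ne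
  refine Measure.integrableOn_of_bounded (M := K) hfin
    (measurable_gradient f).aestronglyMeasurable ?_
  refine (ae_restrict_iff' hU.measurableSet).2 (ae_of_all _ fun x hx => ?_)
  rw [norm_gradient]
  exact norm_fderiv_le_of_piecewise hU hUC hf hK hx

/-- The gradient of a continuous piecewise polynomial is its weak gradient. -/
theorem hasWeakGradient_of_piecewise (hU : IsOpen U) (hUC : U ⊆ ⋃ T ∈ C, simplex T)
    (hf : ∀ T ∈ C, IsPolyOn m (simplex T) f) : HasWeakGradient U f (gradient f) := by
  intro φ hφ hφc hφU e
  obtain ⟨K, hK⟩ := exists_lipschitzOnWith_simplex hf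
  have hloc : LocallyLipschitzOn (tsupport φ) f := by
    intro x hx
    obtain ⟨r, hr, hrU⟩ := Metric.isOpen_iff.1 hU x (hφU hx)
    exact ⟨K, Metric.ball x r, mem_nhdsWithin_of_mem_nhds (Metric.ball_mem_nhds x hr),
      lipschitzOnWith_of_convex hf hK (convex_ball x r) (hrU.trans hUC)⟩
  -- Near the support of `φ` the function `f` may be replaced by a globally Lipschitz extension `F`,
  -- for which integration by parts against `φ` is available.
  obtain ⟨L, hL⟩ := hloc.exists_lipschitzOnWith_of_compact hφc
  obtain ⟨F, hF, hfF⟩ := hL.extend_real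
  obtain ⟨D, hD⟩ := (hφ.of_le (by simp) : ContDiff ℝ 1 φ).lipschitzWith_of_hasCompactSupport hφc
    one_ne_zero
  have hdiff : Differentiable ℝ φ := hφ.differentiable (by simp)
  have hparts := hF.integral_lineDeriv_mul_eq (μ := volume) hD hφc e
  have h1 : ∫ x in U, f x * fderiv ℝ φ x e = ∫ x, F x * fderiv ℝ φ x e := by
    rw [← setIntegral_eq_integral_of_forall_compl_eq_zero (s := U)
      (f := fun x => F x * fderiv ℝ φ x e)]
    · refine setIntegral_congr_fun hU.measurableSet fun x _ => ?_
      by_cases hx : x ∈ tsupport φ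
      · simp only [hfF hx]
      · simp only [fderiv_of_notMem_tsupport ℝ hx, zero_apply, mul_zero]
    · intro x hx
      simp only [fderiv_of_notMem_tsupport ℝ fun h => hx (hφU h), zero_apply, mul_zero]
  have h2 : ∫ x in U, inner ℝ (gradient f x) e * φ x = ∫ x, lineDeriv ℝ F x e * φ x := by
    rw [← setIntegral_eq_integral_of_forall_compl_eq_zero (s := U)
      (f := fun x => lineDeriv ℝ F x e * φ x)]
    · refine setIntegral_congr_ae hU.measurableSet ?_
      filter_upwards [hF.ae_differentiableAt (μ := volume)] with x hx _
      by_cases hφx : φ x = 0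
      · simp [hφx]
      -- Equality on the open set where `φ ≠ 0` transfers the derivative as well as the value.
      · have hev : f =ᶠ[𝓝 x] F := by
          filter_upwards [hdiff.continuous.isOpen_support.mem_nhds hφx] with y hy
          exact hfF (subset_tsupport φ hy)
        rw [inner_gradient_left, hx.lineDeriv_eq_fderiv, hev.fderiv_eq]
    · intro x hx
      simp only [image_eq_zero_of_notMem_tsupport fun h => hx (hφU h), mul_zero]
  rw [h1, h2, hparts, ← integral_neg]
  refine integral_congr_ae (ae_of_all _ fun x => ?_)
  simp only [(hdiff x).lineDeriv_eq_fderiv, map_neg]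
  ring

theorem memW11_of_piecewise (hU : IsOpen U) (hUC : U ⊆ ⋃ T ∈ C, simplex T)
    (hf : ∀ T ∈ C, IsPolyOn m (simplex T) f) : MemW11 U f :=
  ⟨integrableOn_of_piecewise hUC hf, gradient f, integrableOn_gradient_of_piecewise hU hUC hf,
    hasWeakGradient_of_piecewise hU hUC hf⟩

/-! ### Polynomials in barycentric coordinates -/

theorem IsPolyOn.mono {n : ℕ} {S : Set (Eu d)} (hf : IsPolyOn n S f) (h : n ≤ m) :
    IsPolyOn m S f :=
  hf.imp fun _ hp => ⟨hp.1.trans h, hp.2⟩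

theorem IsPolyOn.congr {S : Set (Eu d)} {g : Eu d → ℝ} (hf : IsPolyOn m S f)
    (h : ∀ x ∈ S, g x = f x) : IsPolyOn m S g :=
  hf.imp fun _ hp => ⟨hp.1, fun x hx => (h x hx).trans (hp.2 x hx)⟩

theorem isPolyOn_const (S : Set (Eu d)) (c : ℝ) : IsPolyOn m S fun _ => c :=
  ⟨MvPolynomial.C c, by simp, by simp⟩

theorem IsPolyOn.mul {n : ℕ} {S : Set (Eu d)} {g : Eu d → ℝ} (hf : IsPolyOn m S f)
    (hg : IsPolyOn n S g) : IsPolyOn (m + n) S fun x => f x * g x := by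
  obtain ⟨p, hp, hp'⟩ := hf
  obtain ⟨q, hq, hq'⟩ := hg
  exact ⟨p * q, (MvPolynomial.totalDegree_mul p q).trans (add_le_add hp hq),
    fun x hx => by simp only [map_mul, hp' x hx, hq' x hx]⟩

theorem IsPolyOn.pow {S : Set (Eu d)} (hf : IsPolyOn m S f) (n : ℕ) :
    IsPolyOn (n * m) S fun x => f x ^ n := by
  obtain ⟨p, hp, hp'⟩ := hf
  exact ⟨p ^ n, (MvPolynomial.totalDegree_pow p n).trans (Nat.mul_le_mul_left n hp),
    fun x hx => by simp only [map_pow, hp' x hx]⟩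

theorem isPolyOn_sum {ι : Type*} (s : Finset ι) {S : Set (Eu d)} {g : ι → Eu d → ℝ}
    (hg : ∀ i ∈ s, IsPolyOn m S (g i)) : IsPolyOn m S fun x => ∑ i ∈ s, g i x := by
  choose! p hp hp' using hg
  exact ⟨∑ i ∈ s, p i, MvPolynomial.totalDegree_finsetSum_le hp,
    fun x hx => by rw [map_sum]; exact Finset.sum_congr rfl fun i hi => hp' i hi x hx⟩

theorem isPolyOn_prod {ι : Type*} (s : Finset ι) {S : Set (Eu d)} {g : ι → Eu d → ℝ} {n : ι → ℕ}
    (hg : ∀ i ∈ s, IsPolyOn (n i) S (g i)) :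
    IsPolyOn (∑ i ∈ s, n i) S fun x => ∏ i ∈ s, g i x := by
  choose! p hp hp' using hg
  exact ⟨∏ i ∈ s, p i, (MvPolynomial.totalDegree_finsetProd _ _).trans (Finset.sum_le_sum hp),
    fun x hx => by rw [map_prod]; exact Finset.prod_congr rfl fun i hi => hp' i hi x hx⟩

theorem isPolyOn_affineMap (a : Eu d →ᵃ[ℝ] ℝ) (S : Set (Eu d)) : IsPolyOn 1 S a := by
  have h : ∀ x, a x = ∑ j, a.linear (EuclideanSpace.single j 1) * x j + a 0 := by
    intro x
    have h1 : a x = a.linear x + a 0 := by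
      have := a.map_vadd 0 x
      simpa using this
    have h2 : x = ∑ j, x j • EuclideanSpace.single j (1 : ℝ) := by
      ext l
      simp [Finset.sum_apply, Pi.single_apply]
    rw [h1]
    congr 1
    conv_lhs => rw [h2, map_sum]
    exact Finset.sum_congr rfl fun j _ => by rw [map_smul, smul_eq_mul, mul_comm]
  refine ⟨∑ j, MvPolynomial.C (a.linear (EuclideanSpace.single j 1)) * MvPolynomial.X j
    + MvPolynomial.C (a 0), ?_, fun x _ => by simp [h x]⟩
  refine (MvPolynomial.totalDegree_add _ _).trans (max_le ?_ (by simp))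
  refine MvPolynomial.totalDegree_finsetSum_le fun j _ =>
    (MvPolynomial.totalDegree_mul _ _).trans ?_
  simp

theorem isPolyOn_eval_coords {ι : Type*} [Fintype ι] (b : AffineBasis ι ℝ (Eu d))
    (p : MvPolynomial ι ℝ) (S : Set (Eu d)) :
    IsPolyOn p.totalDegree S fun x => MvPolynomial.eval (b.coords x) p := by
  simp only [MvPolynomial.eval_eq']
  refine isPolyOn_sum _ fun s hs => ?_
  have h1 : IsPolyOn (∑ j, s j) S fun x => ∏ j, b.coords x j ^ s j :=
    isPolyOn_prod _ fun j _ =>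
      ((isPolyOn_affineMap (b.coord j) S).pow (s j)).mono (by simp)
  refine (((isPolyOn_const (m := 0) S (p.coeff s)).mul h1)).mono ?_
  rw [zero_add]
  have := MvPolynomial.le_totalDegree hs
  rwa [Finsupp.sum_fintype _ _ (fun _ => rfl)] at this

end Piecewise

/-! ### Geometry of triangulations -/

namespace Triangulation

variable {d : ℕ} {Ω : Set (Eu d)} (𝒯 : Triangulation Ω)

theorem mem_cellsAt {i : Eu d} {T : Finset (Eu d)} :
    T ∈ 𝒯.cellsAt i ↔ T ∈ 𝒯.cells ∧ i ∈ simplex T := by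
  simp [cellsAt]

theorem closure_eq : closure Ω = ⋃ T ∈ 𝒯.cells, simplex T := by
  rw [← 𝒯.space_eq]
  ext x
  rw [Geometry.SimplicialComplex.mem_space_iff, mem_iUnion₂]
  constructor
  · rintro ⟨s, hs, hx⟩
    obtain ⟨t, ht, hst, hc⟩ := 𝒯.exists_cell s hs
    exact ⟨t, 𝒯.mem_cells.2 ⟨ht, hc⟩, convexHull_mono (Finset.coe_subset.2 hst) hx⟩
  · rintro ⟨T, hT, hx⟩
    exact ⟨T, (𝒯.mem_cells.1 hT).1, hx⟩

theorem exists_basis {T : Finset (Eu d)} (hT : T ∈ 𝒯.cells) :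
    ∃ b : AffineBasis (Fin (d + 1)) ℝ (Eu d), range b = (T : Set (Eu d)) ∧
      ∀ j x, b.coord j x = bary T (b j) x := by
  let e : T ≃ Fin (d + 1) := T.equivFinOfCardEq (𝒯.mem_cells.1 hT).2
  let b₀ : AffineBasis T ℝ (Eu d) :=
    AffineBasis.mk ((↑) : T → Eu d) (𝒯.indep_of_cells hT) (𝒯.span_of_cells hT)
  refine ⟨b₀.reindex e, ?_, fun j x => ?_⟩
  · rw [AffineBasis.coe_reindex, e.symm.surjective.range_comp]
    exact Subtype.range_coe
  · have hj : (b₀.reindex e) j = (e.symm j : Eu d) := rfl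
    rw [hj, bary, dif_pos ⟨𝒯.indep_of_cells hT, 𝒯.span_of_cells hT, (e.symm j).2⟩,
      AffineBasis.coord_reindex]

open Classical in
/-- The vertices of a `d`-simplex of the triangulation, enumerated as an affine basis. -/
def basis (T : Finset (Eu d)) : AffineBasis (Fin (d + 1)) ℝ (Eu d) :=
  if hT : T ∈ 𝒯.cells then (𝒯.exists_basis hT).choose else refBasis d

variable {𝒯} {T T' : Finset (Eu d)}

theorem range_basis (hT : T ∈ 𝒯.cells) : range (𝒯.basis T) = (T : Set (Eu d)) := by
  rw [basis, dif_pos hT]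
  exact (𝒯.exists_basis hT).choose_spec.1

theorem coord_basis (hT : T ∈ 𝒯.cells) (j : Fin (d + 1)) (x : Eu d) :
    (𝒯.basis T).coord j x = bary T (𝒯.basis T j) x := by
  rw [basis, dif_pos hT]
  exact (𝒯.exists_basis hT).choose_spec.2 j x

theorem hull_basis (hT : T ∈ 𝒯.cells) : convexHull ℝ (range (𝒯.basis T)) = simplex T := by
  rw [range_basis hT, simplex]

theorem basis_mem (hT : T ∈ 𝒯.cells) (j : Fin (d + 1)) : 𝒯.basis T j ∈ T := by
  rw [← Finset.mem_coe, ← range_basis hT]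
  exact mem_range_self j

theorem exists_basis_eq (hT : T ∈ 𝒯.cells) {v : Eu d} (hv : v ∈ T) : ∃ j, 𝒯.basis T j = v := by
  rwa [← Finset.mem_coe, ← range_basis hT] at hv

theorem sum_basis {M : Type*} [AddCommMonoid M] (hT : T ∈ 𝒯.cells) (f : Eu d → M) :
    ∑ j, f (𝒯.basis T j) = ∑ v ∈ T, f v :=
  Finset.sum_bij (fun j _ => 𝒯.basis T j) (fun j _ => basis_mem hT j)
    (fun _ _ _ _ h => (𝒯.basis T).ind.injective h)
    (fun _ hv => (exists_basis_eq hT hv).imp fun j hj => ⟨Finset.mem_univ j, hj⟩) fun _ _ => rfl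

theorem prod_basis {M : Type*} [CommMonoid M] (hT : T ∈ 𝒯.cells) (f : Eu d → M) :
    ∏ j, f (𝒯.basis T j) = ∏ v ∈ T, f v :=
  Finset.prod_bij (fun j _ => 𝒯.basis T j) (fun j _ => basis_mem hT j)
    (fun _ _ _ _ h => (𝒯.basis T).ind.injective h)
    (fun _ hv => (exists_basis_eq hT hv).imp fun j hj => ⟨Finset.mem_univ j, hj⟩) fun _ _ => rfl

theorem mem_simplex_iff (hT : T ∈ 𝒯.cells) {x : Eu d} :
    x ∈ simplex T ↔ ∀ j, 0 ≤ (𝒯.basis T).coords x j := by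
  rw [← hull_basis hT, AffineBasis.convexHull_eq_nonneg_coord]
  rfl

theorem coords_mem (hT : T ∈ 𝒯.cells) {x : Eu d} (hx : x ∈ simplex T) :
    (𝒯.basis T).coords x ∈ stdSimplex ℝ (Fin (d + 1)) :=
  coords_mem_stdSimplex _ (by rwa [hull_basis hT])

theorem volume_simplex_pos (hT : T ∈ 𝒯.cells) : 0 < volume.real (simplex T) := by
  rw [← hull_basis hT]
  exact hull_volume_pos _

theorem interior_simplex (hT : T ∈ 𝒯.cells) :
    interior (simplex T) = {x | ∀ j, 0 < (𝒯.basis T).coord j x} := by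
  rw [← hull_basis hT, AffineBasis.interior_convexHull]

theorem interior_simplex_nonempty (hT : T ∈ 𝒯.cells) : (interior (simplex T)).Nonempty := by
  rw [← hull_basis hT]
  exact interior_convexHull_nonempty_iff_affineSpan_eq_top.2 (𝒯.basis T).tot

theorem simplex_subset_closure (hT : T ∈ 𝒯.cells) : simplex T ⊆ closure Ω := by
  rw [𝒯.closure_eq]
  exact subset_biUnion_of_mem (u := fun T => simplex T) hT

theorem exists_notMem_of_ne (hT : T ∈ 𝒯.cells) (hT' : T' ∈ 𝒯.cells) (h : T ≠ T') :
    ∃ v ∈ T, v ∉ T' := by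
  by_contra! hsub
  exact h (Finset.eq_of_subset_of_card_le hsub
    (by rw [(𝒯.mem_cells.1 hT).2, (𝒯.mem_cells.1 hT').2]))

/-- The interior of a cell does not meet other cells. -/
theorem disjoint_interior (hT : T ∈ 𝒯.cells) (hT' : T' ∈ 𝒯.cells) (h : T ≠ T') :
    Disjoint (interior (simplex T)) (simplex T') := by
  rw [Set.disjoint_left]
  intro x hx hx'
  obtain ⟨v, hv, hv'⟩ := exists_notMem_of_ne hT hT' h
  obtain ⟨j, rfl⟩ := exists_basis_eq hT hv
  have h1 := 𝒯.bary_eq_of_mem hT hT' (interior_subset hx) hx' (𝒯.basis T j)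
  rw [bary_of_notMem hv', ← coord_basis hT] at h1
  rw [interior_simplex hT] at hx
  exact (hx j).ne' h1

/-- The overlap lies in the boundary of a convex set, which is null. -/
theorem aedisjoint_simplex (hT : T ∈ 𝒯.cells) (hT' : T' ∈ 𝒯.cells) (h : T ≠ T') :
    AEDisjoint volume (simplex T) (simplex T') := by
  refine measure_mono_null (t := frontier (simplex T)) ?_
    ((convex_simplex T).addHaar_frontier volume)
  rintro x ⟨hx, hx'⟩
  rw [(isCompact_simplex T).isClosed.frontier_eq]
  exact ⟨hx, fun hi => Set.disjoint_left.1 (disjoint_interior hT hT' h) hi hx'⟩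

theorem setIntegral_biUnion_simplex {C : Finset (Finset (Eu d))} (hC : C ⊆ 𝒯.cells)
    {f : Eu d → ℝ} (hf : IntegrableOn f (⋃ T ∈ C, simplex T)) :
    ∫ x in ⋃ T ∈ C, simplex T, f x = ∑ T ∈ C, ∫ x in simplex T, f x := by
  have e : (⋃ T ∈ C, simplex T) = ⋃ T : C, simplex T.1 := by rw [iUnion_subtype]
  have hd : Pairwise (Function.onFun (AEDisjoint volume) fun T : C => simplex T.1) :=
    fun T T' h => aedisjoint_simplex (hC T.2) (hC T'.2) fun h' => h (Subtype.ext h')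
  have hm : ∀ T : C, NullMeasurableSet (simplex T.1) volume :=
    fun T => (isCompact_simplex T.1).measurableSet.nullMeasurableSet
  have h := integral_iUnion_ae hm hd (e ▸ hf)
  rw [tsum_fintype] at h
  rw [e, h]
  exact Finset.sum_coe_sort C fun T => ∫ x in simplex T, f x

theorem cellsAt_subset (i : Eu d) : 𝒯.cellsAt i ⊆ 𝒯.cells := fun _ h => (𝒯.mem_cellsAt.1 h).1

theorem volume_patch (i : Eu d) :
    volume.real (𝒯.patch i) = ∑ T ∈ 𝒯.cellsAt i, volume.real (simplex T) := by
  have h := setIntegral_biUnion_simplex (cellsAt_subset (𝒯 := 𝒯) i) (f := fun _ => 1)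
    (integrableOn_const (isCompact_biUnion_simplex _).measure_ne_top)
  simpa [patch] using h

theorem volume_patch_pos {i : Eu d} (hT : T ∈ 𝒯.cellsAt i) : 0 < volume.real (𝒯.patch i) := by
  rw [volume_patch]
  exact Finset.sum_pos (fun T hT => volume_simplex_pos (cellsAt_subset i hT)) ⟨T, hT⟩

/-! ### Integration over the domain by cells. -/

theorem isCompact_closure (𝒯 : Triangulation Ω) : IsCompact (closure Ω) := by
  rw [𝒯.closure_eq]
  exact isCompact_biUnion_simplex _

theorem interior_simplex_subset (hΩ : IsPolyhedralDomain Ω) (hT : T ∈ 𝒯.cells) :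
    interior (simplex T) ⊆ Ω := by
  rw [← hΩ.interior_closure]
  exact interior_mono (simplex_subset_closure hT)

/-- Interiors of cells lie in Ω because Ω is the interior of its closure. What remains of the
closure is contained in the null boundaries of finitely many cells. -/
theorem ae_eq_closure (hΩ : IsPolyhedralDomain Ω) (𝒯 : Triangulation Ω) :
    Ω =ᵐ[volume] closure Ω := by
  refine subset_closure.eventuallyLE.antisymm ?_
  rw [ae_le_set]
  refine measure_mono_null (t := ⋃ T ∈ 𝒯.cells, frontier (simplex T)) ?_ ?_
  · rintro x ⟨hx, hxΩ⟩
    rw [𝒯.closure_eq] at hx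
    obtain ⟨T, hT, hxT⟩ := mem_iUnion₂.1 hx
    refine mem_iUnion₂.2 ⟨T, hT, ?_⟩
    rw [(isCompact_simplex T).isClosed.frontier_eq]
    exact ⟨hxT, fun h => hxΩ (interior_simplex_subset hΩ hT h)⟩
  · exact (measure_biUnion_null_iff 𝒯.cells.countable_toSet).2 fun T _ =>
      (convex_simplex T).addHaar_frontier volume

/-- Integrals over the domain are sums of integrals over the cells. -/
theorem setIntegral_eq_sum (hΩ : IsPolyhedralDomain Ω) (𝒯 : Triangulation Ω) {f : Eu d → ℝ}
    (hf : ContinuousOn f (closure Ω)) :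
    ∫ x in Ω, f x = ∑ T ∈ 𝒯.cells, ∫ x in simplex T, f x := by
  have hi := hf.integrableOn_compact (μ := volume) 𝒯.isCompact_closure
  rw [setIntegral_congr_set (ae_eq_closure hΩ 𝒯)]
  rw [𝒯.closure_eq] at hi ⊢
  exact setIntegral_biUnion_simplex Subset.rfl hi

theorem subset_biUnion_cells (𝒯 : Triangulation Ω) : Ω ⊆ ⋃ T ∈ 𝒯.cells, simplex T := by
  rw [← 𝒯.closure_eq]
  exact subset_closure

/-- On the intersection of two cells the coordinates with respect to the two enumerations of the
vertices agree up to a permutation. -/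
theorem exists_perm_coords (hT : T ∈ 𝒯.cells) (hT' : T' ∈ 𝒯.cells) :
    ∃ σ : Equiv.Perm (Fin (d + 1)), ∀ x ∈ simplex T, x ∈ simplex T' →
      (𝒯.basis T).coords x = (𝒯.basis T').coords x ∘ σ := by
  classical
  -- Shared vertices are matched with themselves and the others arbitrarily. The arbitrary part is
  -- harmless, since the coordinates of unshared vertices vanish on the intersection.
  obtain ⟨g, hg⟩ := Finset.exists_equiv_extend_of_card_eq (α := Fin (d + 1)) (t := T')
    (by simp [(𝒯.mem_cells.1 hT').2])
    (s := {j | 𝒯.basis T j ∈ T'}) (f := 𝒯.basis T)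
    (by
      intro v hv
      obtain ⟨j, hj, rfl⟩ := Finset.mem_image.1 hv
      simpa using hj)
    ((𝒯.basis T).ind.injective.injOn)
  simp only [Finset.mem_filter, Finset.mem_univ, true_and] at hg
  choose τ hτ using fun j => exists_basis_eq hT' (g j).2
  have hτi : Function.Injective τ := fun j l h => by
    apply g.injective
    apply Subtype.ext
    rw [← hτ j, ← hτ l, h]
  refine ⟨Equiv.ofBijective τ (Finite.injective_iff_bijective.1 hτi), fun x hx hx' => ?_⟩
  ext j
  simp only [Function.comp_apply, Equiv.ofBijective_apply, AffineBasis.coords_apply,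
    coord_basis hT, coord_basis hT', hτ]
  by_cases hj : 𝒯.basis T j ∈ T'
  · rw [hg j hj]
    exact 𝒯.bary_eq_of_mem hT hT' hx hx' _
  · rw [𝒯.bary_eq_of_mem hT hT' hx hx', bary_of_notMem hj, ← 𝒯.bary_eq_of_mem hT hT' hx hx',
      bary_of_notMem]
    intro hgj
    obtain ⟨l, hl⟩ := exists_basis_eq hT hgj
    have hl' : 𝒯.basis T l ∈ T' := hl ▸ (g j).2
    have : l = j := g.injective (Subtype.ext ((hg l hl').trans hl))
    exact hj (this ▸ hl')

/-- Functions on cells that agree on intersections can be glued. -/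
theorem exists_glue (C : Finset (Finset (Eu d))) (p : Finset (Eu d) → Eu d → ℝ)
    (h : ∀ T ∈ C, ∀ T' ∈ C, ∀ x ∈ simplex T, x ∈ simplex T' → p T x = p T' x) :
    ∃ f : Eu d → ℝ, ∀ T ∈ C, ∀ x ∈ simplex T, f x = p T x := by
  classical
  refine ⟨fun x => if hx : ∃ T ∈ C, x ∈ simplex T then p hx.choose x else 0, fun T hT x hx => ?_⟩
  have hex : ∃ T ∈ C, x ∈ simplex T := ⟨T, hT, hx⟩
  simp only [dif_pos hex]
  exact h _ hex.choose_spec.1 T hT x hex.choose_spec.2 hx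

/-! ### Lagrange nodes -/

variable {k : ℕ} {i : Eu d}

theorem exists_cellsAt_of_node (hk : 1 ≤ k) (hi : i ∈ 𝒯.nodes k) :
    ∃ T ∈ 𝒯.cellsAt i, ∃ α : Eu d → ℕ, ∑ v ∈ T, α v = k ∧ i = ∑ v ∈ T, ((α v : ℝ) / k) • v := by
  classical
  simp only [nodes, Finset.mem_biUnion, Finset.mem_image, Finset.mem_piAntidiag] at hi
  obtain ⟨T, hT, α, ⟨hα, -⟩, rfl⟩ := hi
  refine ⟨T, 𝒯.mem_cellsAt.2 ⟨hT, ?_⟩, α, hα, rfl⟩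
  have hk' : (k : ℝ) ≠ 0 := by positivity
  refine (convex_convexHull ℝ _).sum_mem (fun v _ => by positivity) ?_
    fun v hv => subset_convexHull ℝ _ hv
  rw [← Finset.sum_div, ← Nat.cast_sum, hα, div_self hk']

/-- The floor in `multiIndex` loses nothing: the products are integers in the cell that generates
the node, and coordinates agree across all cells that contain it. -/
theorem cast_multiIndex (hk : 1 ≤ k) (hi : i ∈ 𝒯.nodes k) (hT : T ∈ 𝒯.cellsAt i) (v : Eu d) :
    (multiIndex k T i v : ℝ) = k * bary T v i := by
  obtain ⟨T₀, hT₀, α, hα, hiα⟩ := exists_cellsAt_of_node hk hi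
  have h0 := 𝒯.mem_cellsAt.1 hT₀
  have h1 := 𝒯.mem_cellsAt.1 hT
  have hk' : (k : ℝ) ≠ 0 := by positivity
  rw [multiIndex, 𝒯.bary_eq_of_mem h1.1 h0.1 h1.2 h0.2 v]
  by_cases hv : v ∈ T₀
  · have h2 : bary T₀ v i = (α v : ℝ) / k := by
      rw [hiα]
      refine 𝒯.bary_sum h0.1 (fun v => (α v : ℝ) / k) ?_ hv
      rw [← Finset.sum_div, ← Nat.cast_sum, hα, div_self hk']
    rw [h2, mul_div_cancel₀ _ hk', Nat.floor_natCast]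
  · simp [bary_of_notMem hv]

/-- The multi-index of a node with respect to the enumeration of the vertices. -/
def nodeIndex (𝒯 : Triangulation Ω) (k : ℕ) (T : Finset (Eu d)) (i : Eu d) : Fin (d + 1) → ℕ :=
  fun j => multiIndex k T i (𝒯.basis T j)

theorem cast_nodeIndex (hk : 1 ≤ k) (hi : i ∈ 𝒯.nodes k) (hT : T ∈ 𝒯.cellsAt i)
    (j : Fin (d + 1)) : (𝒯.nodeIndex k T i j : ℝ) = k * (𝒯.basis T).coords i j := by
  rw [nodeIndex, cast_multiIndex hk hi hT, ← coord_basis (cellsAt_subset i hT),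
    AffineBasis.coords_apply]

theorem nodeIndex_mem (hk : 1 ≤ k) (hi : i ∈ 𝒯.nodes k) (hT : T ∈ 𝒯.cellsAt i) :
    𝒯.nodeIndex k T i ∈ Finset.univ.piAntidiag k := by
  rw [Finset.mem_piAntidiag]
  refine ⟨?_, fun j _ => Finset.mem_univ j⟩
  have : ((∑ j, 𝒯.nodeIndex k T i j : ℕ) : ℝ) = k := by
    rw [Nat.cast_sum, Finset.sum_congr rfl fun j _ => cast_nodeIndex hk hi hT j, ← Finset.mul_sum]
    simp only [AffineBasis.coords_apply, AffineBasis.sum_coord_apply_eq_one, mul_one]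
  exact_mod_cast this

theorem eq_of_nodeIndex_eq (hk : 1 ≤ k) {i' : Eu d} (hi : i ∈ 𝒯.nodes k) (hi' : i' ∈ 𝒯.nodes k)
    (hT : T ∈ 𝒯.cellsAt i) (hT' : T ∈ 𝒯.cellsAt i')
    (h : 𝒯.nodeIndex k T i = 𝒯.nodeIndex k T i') : i = i' := by
  have hk' : (k : ℝ) ≠ 0 := by positivity
  have hc : ∀ j, (𝒯.basis T).coord j i = (𝒯.basis T).coord j i' := by
    intro j
    have h1 := cast_nodeIndex hk hi hT j
    rw [h, cast_nodeIndex hk hi' hT' j] at h1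
    exact (mul_left_cancel₀ hk' h1).symm
  rw [← (𝒯.basis T).affineCombination_coord_eq_self i,
    ← (𝒯.basis T).affineCombination_coord_eq_self i']
  simp only [hc]

theorem exists_node_of_index (hk : 1 ≤ k) (hT : T ∈ 𝒯.cells) {α : Fin (d + 1) → ℕ}
    (hα : α ∈ Finset.univ.piAntidiag k) :
    ∃ i ∈ 𝒯.nodes k, T ∈ 𝒯.cellsAt i ∧ 𝒯.nodeIndex k T i = α := by
  classical
  have hinj := (𝒯.basis T).ind.injective
  -- Extension by zero, because `piAntidiag` requires the multi-index to be supported on the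
  -- vertices.
  let a : Eu d → ℕ := Function.extend (𝒯.basis T) α 0
  have ha : ∀ j, a (𝒯.basis T j) = α j := fun j => hinj.extend_apply _ _ _
  have hsum : ∑ v ∈ T, a v = k := by
    rw [← sum_basis hT]
    simp only [ha]
    exact (Finset.mem_piAntidiag.1 hα).1
  have hsupp : ∀ v, a v ≠ 0 → v ∈ T := by
    intro v hv
    by_contra hvT
    refine hv (Function.extend_apply' _ _ _ ?_)
    rintro ⟨j, rfl⟩
    exact hvT (basis_mem hT j)
  have hk' : (k : ℝ) ≠ 0 := by positivity
  refine ⟨∑ v ∈ T, ((a v : ℝ) / k) • v, ?_, 𝒯.mem_cellsAt.2 ⟨hT, ?_⟩, ?_⟩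
  · simp only [nodes, Finset.mem_biUnion, Finset.mem_image]
    exact ⟨T, hT, a, Finset.mem_piAntidiag.2 ⟨hsum, hsupp⟩, rfl⟩
  · refine (convex_convexHull ℝ _).sum_mem (fun v _ => by positivity) ?_
      fun v hv => subset_convexHull ℝ _ hv
    rw [← Finset.sum_div, ← Nat.cast_sum, hsum, div_self hk']
  · ext j
    rw [nodeIndex, 𝒯.multiIndex_node hk hT a hsum (basis_mem hT j), ha]

theorem bernstein_eq_eval (hT : T ∈ 𝒯.cellsAt i) {x : Eu d} (hx : x ∈ simplex T) :
    𝒯.bernstein k i x =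
      MvPolynomial.eval ((𝒯.basis T).coords x) (bernPoly (𝒯.nodeIndex k T i)) := by
  have hT' := cellsAt_subset i hT
  rw [𝒯.bernstein_eq k hT hx, eval_bernPoly, bernsteinLocal]
  simp only [nodeIndex, AffineBasis.coords_apply, coord_basis hT']
  rw [sum_basis hT' (multiIndex k T i),
    prod_basis hT' fun v => (Nat.factorial (multiIndex k T i v) : ℝ),
    prod_basis hT' fun v => bary T v x ^ multiIndex k T i v]

/-- A Bernstein function vanishes on the cells that do not contain its node. -/
theorem bernstein_eq_zero (hk : 1 ≤ k) (hi : i ∈ 𝒯.nodes k) (hT : T ∈ 𝒯.cells)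
    (hiT : i ∉ simplex T) {x : Eu d} (hx : x ∈ simplex T) : 𝒯.bernstein k i x = 0 := by
  by_cases h : ∃ T ∈ 𝒯.cellsAt i, x ∈ simplex T
  swap
  · rw [bernstein, dif_neg h]
  obtain ⟨S, hS, hxS⟩ := h
  obtain ⟨hSc, hiS⟩ := 𝒯.mem_cellsAt.1 hS
  rw [𝒯.bernstein_eq k hS hxS, bernsteinLocal]
  -- If every vertex of `S` with nonzero weight at `i` belonged to `T`, then `i` would lie in
  -- `simplex T`. The coordinate of the vertex found here vanishes on the common face and occurs
  -- with positive exponent.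
  obtain ⟨v, hvS, hvT, hv⟩ : ∃ v ∈ S, v ∉ T ∧ bary S v i ≠ 0 := by
    by_contra! hcon
    apply hiT
    have hsum := (𝒯.basis S).linear_combination_coord_eq_self i
    rw [← hsum]
    have hfilter : ∀ j, (𝒯.basis S).coord j i ≠ 0 → 𝒯.basis S j ∈ T := by
      intro j hj
      by_contra hjT
      rw [coord_basis hSc] at hj
      exact hj (hcon _ (basis_mem hSc j) hjT)
    classical
    rw [← Finset.sum_filter_add_sum_filter_not Finset.univ fun j => 𝒯.basis S j ∈ T]
    rw [Finset.sum_eq_zero (s := Finset.univ.filter fun j => 𝒯.basis S j ∉ T), add_zero]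
    · refine (convex_convexHull ℝ _).sum_mem (fun j _ => (mem_simplex_iff hSc).1 hiS j) ?_
        fun j hj => subset_convexHull ℝ _ (by simpa using hj)
      rw [← (𝒯.basis S).sum_coord_apply_eq_one i]
      refine Finset.sum_subset (Finset.subset_univ _) fun j _ hj => ?_
      by_contra h0
      exact hj (by simpa using hfilter j h0)
    · intro j hj
      have : (𝒯.basis S).coord j i = 0 := by
        by_contra h0
        exact (Finset.mem_filter.1 hj).2 (hfilter j h0)
      rw [this, zero_smul]
  have hα : multiIndex k S i v ≠ 0 := by
    have hk' : (k : ℝ) ≠ 0 := by positivity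
    have := cast_multiIndex hk hi hS v
    intro h0
    rw [h0, Nat.cast_zero] at this
    exact (mul_ne_zero hk' hv) this.symm
  rw [Finset.prod_eq_zero (f := fun v => bary S v x ^ multiIndex k S i v) hvS, mul_zero]
  simp only [𝒯.bary_eq_of_mem hSc hT hxS hx, bary_of_notMem hvT, zero_pow hα]

end Triangulation

namespace Triangulation

/-! ### Shape regularity -/

variable {d : ℕ} {Ω : Set (Eu d)} {𝒯 : Triangulation Ω} {T T' : Finset (Eu d)}

theorem coord_mem_Icc (hT : T ∈ 𝒯.cells) {x : Eu d} (hx : x ∈ simplex T) (j : Fin (d + 1)) :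
    (𝒯.basis T).coord j x ∈ Icc (0 : ℝ) 1 := by
  have h := coords_mem hT hx
  refine ⟨h.1 j, ?_⟩
  rw [← h.2]
  exact Finset.single_le_sum (f := (𝒯.basis T).coords x) (fun l _ => h.1 l) (Finset.mem_univ j)

/-- Barycentric coordinates are Lipschitz with a constant determined by an inscribed ball. -/
theorem abs_coord_sub_le (hT : T ∈ 𝒯.cells) {c : Eu d} {r : ℝ} (hr : 0 < r)
    (hb : Metric.closedBall c r ⊆ simplex T) (j : Fin (d + 1)) (x y : Eu d) :
    |(𝒯.basis T).coord j x - (𝒯.basis T).coord j y| ≤ (2 * r)⁻¹ * dist x y := by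
  set a := (𝒯.basis T).coord j with ha
  rcases eq_or_ne x y with rfl | hxy
  · simp
  have hn : 0 < ‖x - y‖ := norm_pos_iff.2 (sub_ne_zero.2 hxy)
  -- The segment from `c - u` to `c + u` is a diameter of the ball parallel to `x - y`; along it the
  -- coordinate stays in [0, 1].
  set u : Eu d := (r / ‖x - y‖) • (x - y) with hu
  have hun : ‖u‖ = r := by
    rw [hu, norm_smul, Real.norm_of_nonneg (by positivity), div_mul_cancel₀ _ hn.ne']
  have h1 := coord_mem_Icc hT (hb (show c + u ∈ _ by simp [hun])) j
  have h2 := coord_mem_Icc hT (hb (show c - u ∈ _ by simp [hun])) j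
  have h3 : a (c + u) - a (c - u) = 2 * (r / ‖x - y‖) * (a x - a y) := by
    have e1 := a.linearMap_vsub (c + u) (c - u)
    have e2 := a.linearMap_vsub x y
    simp only [vsub_eq_sub] at e1 e2
    rw [← e1, ← e2]
    have : c + u - (c - u) = (2 * (r / ‖x - y‖)) • (x - y) := by
      rw [mul_smul, ← hu, two_smul]; abel
    rw [this, map_smul, smul_eq_mul]
  have h4 : |a (c + u) - a (c - u)| ≤ 1 := by
    rw [abs_le]
    constructor <;> linarith [h1.1, h1.2, h2.1, h2.2]
  rw [h3, abs_mul, abs_of_pos (by positivity)] at h4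
  rw [dist_eq_norm]
  have h5 : 2 * (r / ‖x - y‖) * |a x - a y| = 2 * r * |a x - a y| / ‖x - y‖ := by ring
  rw [h5, div_le_one hn] at h4
  rw [inv_mul_eq_div, le_div_iff₀ (by positivity)]
  linarith

theorem lipschitzWith_coords (hT : T ∈ 𝒯.cells) {c : Eu d} {r : ℝ} (hr : 0 < r)
    (hb : Metric.closedBall c r ⊆ simplex T) :
    LipschitzWith (Real.toNNReal (2 * r)⁻¹) (𝒯.basis T).coords := by
  refine LipschitzWith.of_dist_le_mul fun x y => ?_
  rw [dist_pi_le_iff (by positivity)]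
  intro j
  rw [Real.coe_toNNReal _ (by positivity)]
  exact abs_coord_sub_le hT hr hb j x y

/-- Edges are longer than the diameter of an inscribed ball. -/
theorem two_mul_radius_le_dist (hT : T ∈ 𝒯.cells) {c : Eu d} {r : ℝ} (hr : 0 < r)
    (hb : Metric.closedBall c r ⊆ simplex T) {v w : Eu d} (hv : v ∈ T) (hw : w ∈ T)
    (hvw : v ≠ w) : 2 * r ≤ dist v w := by
  obtain ⟨j, rfl⟩ := exists_basis_eq hT hv
  obtain ⟨l, rfl⟩ := exists_basis_eq hT hw
  have h := abs_coord_sub_le hT hr hb j (𝒯.basis T j) (𝒯.basis T l)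
  rw [AffineBasis.coord_apply_eq, AffineBasis.coord_apply_ne _ (fun h => hvw (congrArg _ h)), sub_zero,
    abs_one, inv_mul_eq_div, le_div_iff₀ (by positivity), one_mul] at h
  exact h

theorem dist_le_diam_simplex {x y : Eu d} (hx : x ∈ simplex T) (hy : y ∈ simplex T) :
    dist x y ≤ Metric.diam (simplex T) :=
  Metric.dist_le_diam_of_mem (isCompact_simplex T).isBounded hx hy

theorem vertex_mem_simplex {v : Eu d} (hv : v ∈ T) : v ∈ simplex T := subset_convexHull ℝ _ hv

theorem two_mul_radius_le_diam (hd : 1 ≤ d) (hT : T ∈ 𝒯.cells) {c : Eu d} {r : ℝ} (hr : 0 < r)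
    (hb : Metric.closedBall c r ⊆ simplex T) : 2 * r ≤ Metric.diam (simplex T) := by
  obtain ⟨v, hv, w, hw, hvw⟩ := Finset.one_lt_card.1
    (show 1 < T.card by rw [(𝒯.mem_cells.1 hT).2]; omega)
  exact (two_mul_radius_le_dist hT hr hb hv hw hvw).trans
    (dist_le_diam_simplex (vertex_mem_simplex hv) (vertex_mem_simplex hw))

variable {γ : ℝ}

/-- From 2r ≤ diam T ≤ γr; it makes powers of γ monotone in the exponent. -/
theorem ShapeRegular.two_le (hγ : 𝒯.ShapeRegular γ) (hd : 1 ≤ d) (hT : T ∈ 𝒯.cells) : 2 ≤ γ := by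
  obtain ⟨c, r, hr, hb, hdiam⟩ := hγ.1 T hT
  have := (two_mul_radius_le_diam hd hT hr hb).trans hdiam
  exact le_of_mul_le_mul_right this hr

theorem ShapeRegular.diam_pos (hγ : 𝒯.ShapeRegular γ) (hd : 1 ≤ d) (hT : T ∈ 𝒯.cells) :
    0 < Metric.diam (simplex T) := by
  obtain ⟨c, r, hr, hb, -⟩ := hγ.1 T hT
  linarith [two_mul_radius_le_diam hd hT hr hb]

/-- Cells that share an edge have comparable diameters. -/
theorem ShapeRegular.diam_le_of_common_edge (hγ : 𝒯.ShapeRegular γ) (hd : 1 ≤ d)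
    (hT : T ∈ 𝒯.cells) {v w : Eu d} (hv : v ∈ T) (hw : w ∈ T)
    (hv' : v ∈ T') (hw' : w ∈ T') (hvw : v ≠ w) :
    Metric.diam (simplex T) ≤ γ * Metric.diam (simplex T') := by
  have h2 := hγ.two_le hd hT
  obtain ⟨c, r, hr, hb, hdiam⟩ := hγ.1 T hT
  refine hdiam.trans (mul_le_mul_of_nonneg_left ?_ (by linarith))
  have h3 := two_mul_radius_le_dist hT hr hb hv hw hvw
  have h4 := dist_le_diam_simplex (vertex_mem_simplex hv') (vertex_mem_simplex hw')
  linarith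

/-- The number of cells at a point is bounded in terms of the shape regularity. -/
theorem ShapeRegular.card_cellsAt_le (hγ : 𝒯.ShapeRegular γ) (hd : 1 ≤ d) {i : Eu d}
    (hne : (𝒯.cellsAt i).Nonempty) : ((𝒯.cellsAt i).card : ℝ) ≤ γ ^ d := by
  obtain ⟨T₀, hT₀, hmin⟩ :=
    (𝒯.cellsAt i).exists_min_image (fun T => Metric.diam (simplex T)) hne
  have hγ2 := hγ.two_le hd (cellsAt_subset i hT₀)
  set s := Metric.diam (simplex T₀) with hs
  have hs0 : 0 < s := hγ.diam_pos hd (cellsAt_subset i hT₀)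
  -- Shrinking each cell towards `i` to the smallest diameter `s` keeps it inside itself by
  -- convexity. It then lies within distance `s` of `i` and still contains a ball of radius `s / γ`.
  have hball : ∀ T ∈ 𝒯.cellsAt i, ∃ c : Eu d,
      Metric.closedBall c (s / γ) ⊆ simplex T ∩ Metric.closedBall i s := by
    intro T hT
    obtain ⟨hTc, hiT⟩ := 𝒯.mem_cellsAt.1 hT
    obtain ⟨c, r, hr, hb, hdiam⟩ := hγ.1 T hTc
    set D := Metric.diam (simplex T) with hD
    have hD0 : 0 < D := hγ.diam_pos hd hTc
    have hsD : s ≤ D := hmin T hT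
    have ht0 : 0 < s / D := by positivity
    have ht1 : s / D ≤ 1 := (div_le_one hD0).2 hsD
    refine ⟨i + (s / D) • (c - i), fun y hy => ?_⟩
    set z : Eu d := i + (D / s) • (y - i) with hz
    have hyz : y = i + (s / D) • (z - i) := by
      rw [hz, add_sub_cancel_left, smul_smul, div_mul_div_comm, mul_comm s D, div_self (by positivity),
        one_smul, add_sub_cancel]
    have hzT : z ∈ simplex T := by
      apply hb
      rw [Metric.mem_closedBall, dist_eq_norm] at hy ⊢
      have e : y - (i + (s / D) • (c - i)) = (s / D) • (z - c) := by
        rw [hyz]; module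
      rw [e, norm_smul, Real.norm_of_nonneg ht0.le] at hy
      have h1 : ‖z - c‖ ≤ D / γ := by
        rw [div_mul_eq_mul_div, div_le_iff₀ hD0] at hy
        have h2 : s * ‖z - c‖ ≤ s * (D / γ) := by
          calc _ ≤ _ := hy
            _ = _ := by ring
        exact le_of_mul_le_mul_left h2 hs0
      refine h1.trans ?_
      rw [div_le_iff₀ (by linarith), mul_comm]
      exact hdiam
    constructor
    · rw [hyz]
      exact (convex_simplex T).add_smul_sub_mem hiT hzT ⟨ht0.le, ht1⟩
    · rw [Metric.mem_closedBall, dist_eq_norm, hyz, add_sub_cancel_left, norm_smul,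
        Real.norm_of_nonneg ht0.le, div_mul_eq_mul_div, div_le_iff₀ hD0]
      refine mul_le_mul_of_nonneg_left ?_ hs0.le
      rw [← dist_eq_norm]
      exact dist_le_diam_simplex hzT hiT
  choose! c hc using hball
  -- Volume packing: these balls are almost disjoint and fit into the ball of radius `s` about `i`.
  have hvol : ∑ T ∈ 𝒯.cellsAt i, volume (Metric.closedBall (c T) (s / γ)) ≤
      volume (Metric.closedBall i s) := by
    rw [← measure_biUnion_finset₀ (μ := volume) (s := 𝒯.cellsAt i)
      (f := fun T => Metric.closedBall (c T) (s / γ))]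
    · exact measure_mono (iUnion₂_subset fun T hT => (hc T hT).trans inter_subset_right)
    · intro T hT T' hT' hne
      exact (aedisjoint_simplex (cellsAt_subset i hT) (cellsAt_subset i hT') hne).mono
        ((hc T hT).trans inter_subset_left) ((hc T' hT').trans inter_subset_left)
    · exact fun T _ => Metric.isClosed_closedBall.measurableSet.nullMeasurableSet
  have hγ0 : 0 < γ := by linarith
  have hfin : volume (Metric.ball (0 : Eu d) 1) ≠ ⊤ := measure_ball_lt_top.ne
  have hpos : 0 < (volume (Metric.ball (0 : Eu d) 1)).toReal :=
    ENNReal.toReal_pos (Metric.measure_ball_pos volume 0 one_pos).ne' hfin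
  simp only [Measure.addHaar_closedBall _ _ (show 0 ≤ s / γ by positivity),
    Measure.addHaar_closedBall _ _ hs0.le, Finset.sum_const, nsmul_eq_mul,
    finrank_euclideanSpace, Fintype.card_fin] at hvol
  have hreal := ENNReal.toReal_mono (by finiteness) hvol
  simp only [ENNReal.toReal_mul, ENNReal.toReal_natCast] at hreal
  rw [ENNReal.toReal_ofReal (by positivity), ENNReal.toReal_ofReal (by positivity), ← mul_assoc]
    at hreal
  have h5 := le_of_mul_le_mul_right hreal hpos
  rw [div_pow, mul_div_assoc', div_le_iff₀ (by positivity), mul_comm (s ^ d)] at h5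
  exact le_of_mul_le_mul_right h5 (by positivity)

/-! ### Connectivity of patches -/

/-- Two cells at the same point are adjacent if they share an edge. -/
def edgeGraph (𝒯 : Triangulation Ω) (x : Eu d) : SimpleGraph (𝒯.cellsAt x) where
  Adj S S' := S ≠ S' ∧ ∃ v w, v ≠ w ∧ v ∈ S.1 ∧ w ∈ S.1 ∧ v ∈ S'.1 ∧ w ∈ S'.1
  symm := ⟨fun _ _ ⟨h, v, w, hvw, h1, h2, h3, h4⟩ => ⟨h.symm, v, w, hvw, h3, h4, h1, h2⟩⟩
  loopless := ⟨fun _ h => h.1 rfl⟩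

/-- Cells at `x` without a common edge meet only in `x`. -/
theorem eq_of_not_common_edge {x y : Eu d} (hT : T ∈ 𝒯.cellsAt x) (hT' : T' ∈ 𝒯.cellsAt x)
    (h : ∀ v w, v ∈ T → w ∈ T → v ∈ T' → w ∈ T' → v = w) (hy : y ∈ simplex T)
    (hy' : y ∈ simplex T') : y = x := by
  classical
  obtain ⟨hTc, hx⟩ := 𝒯.mem_cellsAt.1 hT
  obtain ⟨hTc', hx'⟩ := 𝒯.mem_cellsAt.1 hT'
  -- The intersection lies in the hull of the shared vertices, of which there is at most one.
  have hsub := 𝒯.inter_subset_convexHull (𝒯.mem_cells.1 hTc).1 (𝒯.mem_cells.1 hTc').1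
  have hs : ((T : Set (Eu d)) ∩ T').Subsingleton := fun v hv w hw => h v w hv.1 hw.1 hv.2 hw.2
  rcases hs.eq_empty_or_singleton with h0 | ⟨v, hv⟩
  · rw [h0, convexHull_empty] at hsub
    exact absurd (hsub ⟨hx, hx'⟩) (notMem_empty x)
  · rw [hv, convexHull_singleton] at hsub
    exact (hsub ⟨hy, hy'⟩).trans (hsub ⟨hx, hx'⟩).symm

theorem exists_ne_mem_simplex (hd : 1 ≤ d) (hT : T ∈ 𝒯.cells) (x : Eu d) :
    ∃ y ∈ simplex T, y ≠ x := by
  obtain ⟨v, hv, w, hw, hvw⟩ := Finset.one_lt_card.1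
    (show 1 < T.card by rw [(𝒯.mem_cells.1 hT).2]; omega)
  by_cases h : v = x
  · exact ⟨w, vertex_mem_simplex hw, fun h' => hvw (h.trans h'.symm)⟩
  · exact ⟨v, vertex_mem_simplex hv, h⟩

/-- Small neighbourhoods of `x` only meet the cells at `x`. -/
theorem exists_open_inter_subset_patch (𝒯 : Triangulation Ω) (x : Eu d) :
    ∃ O : Set (Eu d), IsOpen O ∧ x ∈ O ∧ O ∩ closure Ω ⊆ 𝒯.patch x := by
  classical
  refine ⟨(⋃ T ∈ 𝒯.cells \ 𝒯.cellsAt x, simplex T)ᶜ,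
    (isCompact_biUnion_simplex _).isClosed.isOpen_compl, ?_, ?_⟩
  · simp only [mem_compl_iff, mem_iUnion₂, not_exists]
    intro T hT hx
    rw [Finset.mem_sdiff] at hT
    exact hT.2 (𝒯.mem_cellsAt.2 ⟨hT.1, hx⟩)
  · rintro y ⟨hyO, hy⟩
    rw [𝒯.closure_eq] at hy
    obtain ⟨T, hT, hyT⟩ := mem_iUnion₂.1 hy
    refine mem_iUnion₂.2 ⟨T, ?_, hyT⟩
    by_contra hTx
    exact hyO (mem_iUnion₂.2 ⟨T, Finset.mem_sdiff.2 ⟨hT, hTx⟩, hyT⟩)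

/-- A connected subset of the punctured patch that meets all cells. -/
theorem exists_preconnected_link (hΩ : IsPolyhedralDomain Ω) (hd : 2 ≤ d) {x : Eu d}
    (hx : x ∈ closure Ω) :
    ∃ W : Set (Eu d), IsPreconnected W ∧ x ∉ W ∧ W ⊆ 𝒯.patch x ∧
      ∀ T ∈ 𝒯.cellsAt x, (W ∩ simplex T).Nonempty := by
  obtain ⟨O, hO, hxO, hOp⟩ := 𝒯.exists_open_inter_subset_patch x
  by_cases hxΩ : x ∈ Ω
  -- At a point of Ω a small sphere serves; it is connected because `d ≥ 2`.
  · obtain ⟨ε, hε, hball⟩ := Metric.isOpen_iff.1 (hO.inter hΩ.isOpen) x ⟨hxO, hxΩ⟩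
    have hrank : 1 < Module.rank ℝ (Eu d) := by
      rw [← Module.finrank_eq_rank, finrank_euclideanSpace, Fintype.card_fin]
      exact_mod_cast hd
    have hev : ∀ᶠ ρ : ℝ in 𝓝[>] 0, ∀ T ∈ 𝒯.cellsAt x,
        (Metric.sphere x ρ ∩ simplex T).Nonempty := by
      rw [Filter.eventually_all_finset]
      intro T hT
      obtain ⟨hTc, hxT⟩ := 𝒯.mem_cellsAt.1 hT
      obtain ⟨y, hy, hyx⟩ := exists_ne_mem_simplex (by omega) hTc x
      have hn : 0 < ‖y - x‖ := norm_pos_iff.2 (sub_ne_zero.2 hyx)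
      filter_upwards [Ioo_mem_nhdsGT hn] with ρ hρ
      have h0 : 0 ≤ ρ / ‖y - x‖ := div_nonneg hρ.1.le hn.le
      refine ⟨x + (ρ / ‖y - x‖) • (y - x), ?_, (convex_simplex T).add_smul_sub_mem hxT hy
        ⟨h0, (div_le_one hn).2 hρ.2.le⟩⟩
      rw [mem_sphere_iff_norm, add_sub_cancel_left, norm_smul, Real.norm_of_nonneg h0,
        div_mul_cancel₀ _ hn.ne']
    obtain ⟨ρ, hρ, hρε⟩ := (hev.and (Ioo_mem_nhdsGT hε)).exists
    refine ⟨Metric.sphere x ρ, isPreconnected_sphere hrank x ρ, ?_, fun y hy => ?_, hρ⟩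
    · simpa using hρε.1.ne
    · have : y ∈ Metric.ball x ε := by
        rw [Metric.mem_ball, Metric.mem_sphere.1 hy]
        exact hρε.2
      exact hOp ⟨(hball this).1, subset_closure (hball this).2⟩
  · have hfr : x ∈ frontier Ω := by
      rw [hΩ.isOpen.frontier_eq]
      exact ⟨hx, hxΩ⟩
    -- At a boundary point the connected set is a piece of Ω itself, which does not contain `x`
    -- since `x ∉ Ω`.
    obtain ⟨V, hVO, hV, hxV, hconn⟩ := hΩ.connected_at_boundary x hfr O (hO.mem_nhds hxO)
    refine ⟨V ∩ Ω, hconn.isPreconnected, fun h => hxΩ h.2,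
      fun y hy => hOp ⟨hVO hy.1, subset_closure hy.2⟩, fun T hT => ?_⟩
    obtain ⟨hTc, hxT⟩ := 𝒯.mem_cellsAt.1 hT
    have hcl : x ∈ closure (interior (simplex T)) := by
      rw [(convex_simplex T).closure_interior_eq_closure_of_nonempty_interior
        (interior_simplex_nonempty hTc)]
      exact subset_closure hxT
    obtain ⟨y, hyV, hyT⟩ := mem_closure_iff.1 hcl V hV hxV
    exact ⟨y, ⟨hyV, interior_simplex_subset hΩ hTc hyT⟩, interior_subset hyT⟩

/-- Cells of different components share no edge and hence meet only in `x`. Two families of such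
cells would split a connected subset of the punctured patch into two nonempty closed parts. -/
theorem edgeGraph_preconnected (hΩ : IsPolyhedralDomain Ω) (hd : 2 ≤ d) {x : Eu d}
    (hx : x ∈ closure Ω) : (𝒯.edgeGraph x).Preconnected := by
  classical
  intro S S'
  by_contra hSS'
  obtain ⟨W, hW, hxW, hWp, hWT⟩ := exists_preconnected_link (𝒯 := 𝒯) hΩ hd hx
  let A : Finset (𝒯.cellsAt x) := {R | (𝒯.edgeGraph x).Reachable S R}
  let B : Finset (𝒯.cellsAt x) := {R | ¬ (𝒯.edgeGraph x).Reachable S R}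
  have hclosed : ∀ D : Finset (𝒯.cellsAt x), IsClosed (⋃ R ∈ D, simplex R.1) := fun D =>
    (D.isCompact_biUnion fun R _ => isCompact_simplex R.1).isClosed
  obtain ⟨y, hyW, hyA, hyB⟩ := isPreconnected_closed_iff.1 hW (⋃ R ∈ A, simplex R.1)
    (⋃ R ∈ B, simplex R.1) (hclosed A) (hclosed B)
    (by
      intro y hy
      obtain ⟨R, hR, hyR⟩ := mem_iUnion₂.1 (hWp hy)
      by_cases hr : (𝒯.edgeGraph x).Reachable S ⟨R, hR⟩
      · exact Or.inl (mem_iUnion₂.2 ⟨⟨R, hR⟩, by simpa [A] using hr, hyR⟩)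
      · exact Or.inr (mem_iUnion₂.2 ⟨⟨R, hR⟩, by simpa [B] using hr, hyR⟩))
    (by
      obtain ⟨y, hyW, hyS⟩ := hWT S.1 S.2
      exact ⟨y, hyW, mem_iUnion₂.2 ⟨S, by simp [A], hyS⟩⟩)
    (by
      obtain ⟨y, hyW, hyS⟩ := hWT S'.1 S'.2
      exact ⟨y, hyW, mem_iUnion₂.2 ⟨S', by simpa [B] using hSS', hyS⟩⟩)
  obtain ⟨R, hR, hyR⟩ := mem_iUnion₂.1 hyA
  obtain ⟨R', hR', hyR'⟩ := mem_iUnion₂.1 hyB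
  have hR1 : (𝒯.edgeGraph x).Reachable S R := by simpa [A] using hR
  have hR2 : ¬ (𝒯.edgeGraph x).Reachable S R' := by simpa [B] using hR'
  have hne : R ≠ R' := fun h => hR2 (h ▸ hR1)
  have hyx : y = x := by
    refine eq_of_not_common_edge R.2 R'.2 (fun v w h1 h2 h3 h4 => ?_) hyR hyR'
    by_contra hvw
    exact hR2 (hR1.trans (SimpleGraph.Adj.reachable ⟨hne, v, w, hvw, h1, h2, h3, h4⟩))
  exact hxW (hyx ▸ hyW)

/-- All cells at a point have comparable diameters. -/
theorem ShapeRegular.diam_le_diam (hγ : 𝒯.ShapeRegular γ) (hΩ : IsPolyhedralDomain Ω) (hd : 1 ≤ d)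
    {x : Eu d} (hT : T ∈ 𝒯.cellsAt x) (hT' : T' ∈ 𝒯.cellsAt x) :
    Metric.diam (simplex T) ≤ γ ^ (⌊γ ^ d⌋₊ + 1) * Metric.diam (simplex T') := by
  classical
  obtain ⟨hTc, hxT⟩ := 𝒯.mem_cellsAt.1 hT
  obtain ⟨hTc', hxT'⟩ := 𝒯.mem_cellsAt.1 hT'
  have hγ1 : 1 ≤ γ := by linarith [hγ.two_le hd hTc]
  have hpow : ∀ n ≤ ⌊γ ^ d⌋₊ + 1, γ ^ n * Metric.diam (simplex T') ≤
      γ ^ (⌊γ ^ d⌋₊ + 1) * Metric.diam (simplex T') := fun n hn =>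
    mul_le_mul_of_nonneg_right (pow_le_pow_right₀ hγ1 hn) Metric.diam_nonneg
  rcases hd.eq_or_lt with hd1 | hd2
  · refine le_trans ?_ (hpow 1 (by omega))
    rw [pow_one]
    exact hγ.2 hd1.symm T hTc T' hTc' ⟨x, hxT, hxT'⟩
  · have hwalk : ∀ (S S' : 𝒯.cellsAt x) (p : (𝒯.edgeGraph x).Walk S S'),
        Metric.diam (simplex S.1) ≤ γ ^ p.length * Metric.diam (simplex S'.1) := by
      intro S S' p
      induction p with
      | nil => simp
      | @cons S R S' h p ih =>
        rw [SimpleGraph.Walk.length_cons, pow_succ', mul_assoc]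
        obtain ⟨-, v, w, hvw, h1, h2, h3, h4⟩ := h
        exact (hγ.diam_le_of_common_edge hd (cellsAt_subset x S.2) h1 h2 h3 h4 hvw).trans
          (mul_le_mul_of_nonneg_left ih (by linarith))
    -- A path repeats no cell, so its length is less than the number of cells at `x`, and each of
    -- its edges costs one factor γ.
    obtain ⟨p, hp⟩ := (edgeGraph_preconnected hΩ hd2 (simplex_subset_closure hTc hxT)
      ⟨T, hT⟩ ⟨T', hT'⟩).exists_isPath
    refine (hwalk _ _ p).trans (hpow _ ?_)
    have h1 := hp.length_lt
    rw [Fintype.card_coe] at h1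
    have h2 := Nat.le_floor (hγ.card_cellsAt_le hd ⟨T, hT⟩)
    omega

theorem ShapeRegular.diam_patch_le (hγ : 𝒯.ShapeRegular γ) (hΩ : IsPolyhedralDomain Ω) (hd : 1 ≤ d)
    {x : Eu d} (hT : T ∈ 𝒯.cellsAt x) :
    Metric.diam (𝒯.patch x) ≤ 2 * γ ^ (⌊γ ^ d⌋₊ + 1) * Metric.diam (simplex T) := by
  have hγ2 := hγ.two_le hd (cellsAt_subset x hT)
  refine Metric.diam_le_of_forall_dist_le (by positivity) fun y hy z hz => ?_
  have key : ∀ y ∈ 𝒯.patch x,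
      dist y x ≤ γ ^ (⌊γ ^ d⌋₊ + 1) * Metric.diam (simplex T) := by
    intro y hy
    obtain ⟨S, hS, hyS⟩ := mem_iUnion₂.1 hy
    exact (dist_le_diam_simplex hyS (𝒯.mem_cellsAt.1 hS).2).trans (hγ.diam_le_diam hΩ hd hS hT)
  calc dist y z ≤ dist y x + dist x z := dist_triangle _ _ _
    _ = dist y x + dist z x := by rw [dist_comm x z]
    _ ≤ _ := add_le_add (key y hy) (key z hz)
    _ = _ := by ring

end Triangulation

/-! ### Bounds on the reference simplex -/

section Bounds

open scoped NNReal

variable {ι κ : Type*} [Fintype ι]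

theorem contDiff_eval_pi (p : MvPolynomial ι ℝ) :
    ContDiff ℝ 1 fun x : ι → ℝ => MvPolynomial.eval x p := by
  induction p using MvPolynomial.induction_on with
  | C a => simpa using contDiff_const
  | add p q hp hq => simpa using hp.add hq
  | mul_X p j hp =>
    simp only [map_mul, MvPolynomial.eval_X]
    exact hp.mul (by fun_prop)

theorem exists_bound_on_stdSimplex (s : Finset κ) (p : κ → MvPolynomial ι ℝ) :
    ∃ B : ℝ, ∀ a ∈ s, ∀ x ∈ stdSimplex ℝ ι, |MvPolynomial.eval x (p a)| ≤ B := by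
  choose B hB using fun a => (isCompact_stdSimplex ℝ ι).exists_bound_of_continuousOn
    (MvPolynomial.continuous_eval (p a)).continuousOn
  refine ⟨∑ a ∈ s, |B a|, fun a ha x hx => ?_⟩
  calc _ ≤ B a := hB a x hx
    _ ≤ |B a| := le_abs_self _
    _ ≤ _ := Finset.single_le_sum (f := fun a => |B a|) (fun _ _ => abs_nonneg _) ha

theorem exists_lipschitz_on_stdSimplex (s : Finset κ) (p : κ → MvPolynomial ι ℝ) :
    ∃ L : ℝ≥0, ∀ a ∈ s,
      LipschitzOnWith L (fun x => MvPolynomial.eval x (p a)) (stdSimplex ℝ ι) := by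
  choose L hL using fun a => LocallyLipschitzOn.exists_lipschitzOnWith_of_compact
    (isCompact_stdSimplex ℝ ι) (contDiff_eval_pi (p a)).locallyLipschitz.locallyLipschitzOn
  exact ⟨s.sup L, fun a ha => (hL a).weaken (Finset.le_sup ha)⟩

end Bounds

/-! ### The global dual basis -/

namespace Triangulation

open MvPolynomial

variable {d k : ℕ} {Ω : Set (Eu d)} {𝒯 : Triangulation Ω} {T T' : Finset (Eu d)} {i j : Eu d}

theorem isPolyOn_bernstein (hk : 1 ≤ k) (hi : i ∈ 𝒯.nodes k) (hT : T ∈ 𝒯.cells) :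
    IsPolyOn k (simplex T) (𝒯.bernstein k i) := by
  by_cases hiT : i ∈ simplex T
  · have hT' := 𝒯.mem_cellsAt.2 ⟨hT, hiT⟩
    refine ((isPolyOn_eval_coords (𝒯.basis T) (bernPoly (𝒯.nodeIndex k T i)) _).mono ?_).congr
      fun x hx => bernstein_eq_eval hT' hx
    exact (totalDegree_bernPoly_le _).trans (Finset.mem_piAntidiag.1 (nodeIndex_mem hk hi hT')).1.le
  · exact (isPolyOn_const _ 0).congr fun x hx => bernstein_eq_zero hk hi hT hiT hx

theorem continuousOn_closure_of_piecewise {m : ℕ} {f : Eu d → ℝ}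
    (hf : ∀ T ∈ 𝒯.cells, IsPolyOn m (simplex T) f) : ContinuousOn f (closure Ω) := by
  rw [𝒯.closure_eq]
  exact continuousOn_biUnion_simplex hf

theorem setIntegral_simplex_eval (hT : T ∈ 𝒯.cells) (p : MvPolynomial (Fin (d + 1)) ℝ) :
    ∫ x in simplex T, eval ((𝒯.basis T).coords x) p =
      volume.real (simplex T) * refIntegral d p := by
  rw [← hull_basis hT]
  exact integral_hull_eval_coords _ p

theorem exists_perm_nodeIndex (hT : T ∈ 𝒯.cellsAt i) (hT' : T' ∈ 𝒯.cellsAt i) :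
    ∃ σ : Equiv.Perm (Fin (d + 1)), 𝒯.nodeIndex k T i = 𝒯.nodeIndex k T' i ∘ σ ∧
      ∀ x ∈ simplex T, x ∈ simplex T' →
        (𝒯.basis T).coords x = (𝒯.basis T').coords x ∘ σ := by
  obtain ⟨hTc, hiT⟩ := 𝒯.mem_cellsAt.1 hT
  obtain ⟨hTc', hiT'⟩ := 𝒯.mem_cellsAt.1 hT'
  obtain ⟨σ, hσ⟩ := exists_perm_coords hTc hTc'
  refine ⟨σ, ?_, hσ⟩
  ext l
  have h := congrFun (hσ i hiT hiT') l
  simp only [Function.comp_apply, AffineBasis.coords_apply, coord_basis hTc, coord_basis hTc'] at h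
  simp only [nodeIndex, multiIndex, Function.comp_apply, h]

/-- The two multi-indices differ by a permutation of the vertices, under which the reference
integral is invariant. Hence one factor suffices for all cells of the patch. -/
theorem refIntegral_nodeIndex_eq (hT : T ∈ 𝒯.cellsAt i) (hT' : T' ∈ 𝒯.cellsAt i) :
    refIntegral d (bernPoly (𝒯.nodeIndex k T i)) = refIntegral d (bernPoly (𝒯.nodeIndex k T' i)) := by
  obtain ⟨σ, hσ, -⟩ := exists_perm_nodeIndex (k := k) hT hT'
  rw [hσ, ← (isSimplexIntegral_refIntegral d).rename_perm σ, rename_perm_bernPoly]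

/-- The integral of a Bernstein function. -/
theorem integral_bernstein (hΩ : IsPolyhedralDomain Ω) (hk : 1 ≤ k) (hi : i ∈ 𝒯.nodes k)
    (hT : T ∈ 𝒯.cellsAt i) :
    ∫ x in Ω, 𝒯.bernstein k i x =
      volume.real (𝒯.patch i) * refIntegral d (bernPoly (𝒯.nodeIndex k T i)) := by
  rw [setIntegral_eq_sum hΩ 𝒯
    (continuousOn_closure_of_piecewise fun T hT => isPolyOn_bernstein hk hi hT),
    ← Finset.sum_subset (cellsAt_subset i), volume_patch, Finset.sum_mul]
  · refine Finset.sum_congr rfl fun S hS => ?_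
    rw [← refIntegral_nodeIndex_eq hS hT, ← setIntegral_simplex_eval (cellsAt_subset i hS)]
    exact setIntegral_congr_fun (isCompact_simplex S).measurableSet
      fun x hx => bernstein_eq_eval hS hx
  · intro S hS hiS
    have hiS' : i ∉ simplex S := fun h => hiS (𝒯.mem_cellsAt.2 ⟨hS, h⟩)
    exact setIntegral_eq_zero_of_forall_eq_zero fun x hx => bernstein_eq_zero hk hi hS hiS' hx

/-- The functions `ζ i` are the factors of the dual basis functions that arise from the local
polynomials `Z`. -/
def IsDualFactor (𝒯 : Triangulation Ω) (k : ℕ)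
    (Z : (Fin (d + 1) → ℕ) → MvPolynomial (Fin (d + 1)) ℝ) (ζ : Eu d → Eu d → ℝ) : Prop :=
  ∀ i, ∀ T ∈ 𝒯.cellsAt i, ∀ x ∈ simplex T, ζ i x = (volume.real (𝒯.patch i))⁻¹ *
    eval ((𝒯.basis T).coords x) (Z (𝒯.nodeIndex k T i))

variable {Z : (Fin (d + 1) → ℕ) → MvPolynomial (Fin (d + 1)) ℝ} {ζ : Eu d → Eu d → ℝ}

/-- Equivariant local polynomials can be glued. -/
theorem exists_isDualFactor (𝒯 : Triangulation Ω) (k : ℕ)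
    (hZ : ∀ (σ : Equiv.Perm (Fin (d + 1))) α x, eval (x ∘ σ) (Z (α ∘ σ)) = eval x (Z α)) :
    ∃ ζ, 𝒯.IsDualFactor k Z ζ := by
  choose ζ hζ using fun i => exists_glue (𝒯.cellsAt i) (fun T x => (volume.real (𝒯.patch i))⁻¹ *
    eval ((𝒯.basis T).coords x) (Z (𝒯.nodeIndex k T i))) fun T hT T' hT' x hx hx' => by
      obtain ⟨σ, hσ, hσx⟩ := exists_perm_nodeIndex (k := k) hT hT'
      simp only [hσ, hσx x hx hx', hZ]
  exact ⟨ζ, hζ⟩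

/-! ### Biorthogonality, mass and bounds of the glued functions. -/

namespace IsDualFactor

theorem mul_eq (hζ : 𝒯.IsDualFactor k Z ζ) (hT : T ∈ 𝒯.cellsAt i) {x : Eu d}
    (hx : x ∈ simplex T) :
    𝒯.bernstein k i x * ζ i x = (volume.real (𝒯.patch i))⁻¹ *
      eval ((𝒯.basis T).coords x) (bernPoly (𝒯.nodeIndex k T i) * Z (𝒯.nodeIndex k T i)) := by
  rw [hζ i T hT x hx, bernstein_eq_eval hT hx, map_mul]
  ring

theorem isPolyOn (hζ : 𝒯.IsDualFactor k Z ζ) {m : ℕ} (hZ : ∀ α, (Z α).totalDegree ≤ m)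
    (hT : T ∈ 𝒯.cellsAt i) : IsPolyOn m (simplex T) (ζ i) := by
  have h := (isPolyOn_const (m := 0) (simplex T) (volume.real (𝒯.patch i))⁻¹).mul
    ((isPolyOn_eval_coords (𝒯.basis T) (Z (𝒯.nodeIndex k T i)) (simplex T)).mono (hZ _))
  rw [zero_add] at h
  exact h.congr fun x hx => hζ i T hT x hx

theorem isPolyOn_mul (hζ : 𝒯.IsDualFactor k Z ζ) {m : ℕ} (hZ : ∀ α, (Z α).totalDegree ≤ m)
    (hk : 1 ≤ k) (hi : i ∈ 𝒯.nodes k) (hT : T ∈ 𝒯.cells) :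
    IsPolyOn (k + m) (simplex T) fun x => 𝒯.bernstein k i x * ζ i x := by
  by_cases hiT : i ∈ simplex T
  · exact (isPolyOn_bernstein hk hi hT).mul (hζ.isPolyOn hZ (𝒯.mem_cellsAt.2 ⟨hT, hiT⟩))
  · exact (isPolyOn_const _ 0).congr fun x hx => by
      rw [bernstein_eq_zero hk hi hT hiT hx, zero_mul]

/-- Within a cell, distinct nodes have distinct multi-indices, so local duality separates them; a
cell without `i` contributes nothing because `b_i` vanishes there. -/
theorem integral_mul_simplex (hζ : 𝒯.IsDualFactor k Z ζ)
    (hdual : ∀ α ∈ Finset.univ.piAntidiag k, ∀ β ∈ Finset.univ.piAntidiag k,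
      refIntegral d (bernPoly β * (bernPoly α * Z α)) = if α = β then 1 else 0)
    (hk : 1 ≤ k) (hi : i ∈ 𝒯.nodes k) (hj : j ∈ 𝒯.nodes k) (hT : T ∈ 𝒯.cellsAt j) :
    ∫ x in simplex T, 𝒯.bernstein k i x * (𝒯.bernstein k j x * ζ j x) =
      (volume.real (𝒯.patch j))⁻¹ * (volume.real (simplex T) * indicator {i} 1 j) := by
  have hTc := cellsAt_subset j hT
  by_cases hiT : i ∈ simplex T
  · have hT' := 𝒯.mem_cellsAt.2 ⟨hTc, hiT⟩
    have h1 : ∫ x in simplex T, 𝒯.bernstein k i x * (𝒯.bernstein k j x * ζ j x) =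
        ∫ x in simplex T, (volume.real (𝒯.patch j))⁻¹ * eval ((𝒯.basis T).coords x)
          (bernPoly (𝒯.nodeIndex k T i) *
            (bernPoly (𝒯.nodeIndex k T j) * Z (𝒯.nodeIndex k T j))) := by
      refine setIntegral_congr_fun (isCompact_simplex T).measurableSet fun x hx => ?_
      simp only [hζ.mul_eq hT hx, bernstein_eq_eval hT' hx, map_mul]
      ring
    rw [h1, integral_const_mul, setIntegral_simplex_eval hTc,
      hdual _ (nodeIndex_mem hk hj hT) _ (nodeIndex_mem hk hi hT')]
    by_cases hij : j = i
    · subst hij; simp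
    · rw [if_neg fun h => hij (eq_of_nodeIndex_eq hk hj hi hT hT' h),
        indicator_of_notMem (by simpa using hij)]
  · have hij : j ≠ i := fun h => hiT (h ▸ (𝒯.mem_cellsAt.1 hT).2)
    rw [indicator_of_notMem (by simpa using hij), mul_zero, mul_zero]
    exact setIntegral_eq_zero_of_forall_eq_zero fun x hx => by
      rw [bernstein_eq_zero hk hi hTc hiT hx, zero_mul]

theorem continuousOn_bernstein_mul (hζ : 𝒯.IsDualFactor k Z ζ) {m : ℕ}
    (hZ : ∀ α, (Z α).totalDegree ≤ m) (hk : 1 ≤ k) (hi : i ∈ 𝒯.nodes k) (hj : j ∈ 𝒯.nodes k) :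
    ContinuousOn (fun x => 𝒯.bernstein k i x * (𝒯.bernstein k j x * ζ j x)) (closure Ω) :=
  continuousOn_closure_of_piecewise fun _ hT =>
    (isPolyOn_bernstein hk hi hT).mul (hζ.isPolyOn_mul hZ hk hj hT)

theorem biorthogonal (hζ : 𝒯.IsDualFactor k Z ζ) (hΩ : IsPolyhedralDomain Ω) {m : ℕ}
    (hZ : ∀ α, (Z α).totalDegree ≤ m)
    (hdual : ∀ α ∈ Finset.univ.piAntidiag k, ∀ β ∈ Finset.univ.piAntidiag k,
      refIntegral d (bernPoly β * (bernPoly α * Z α)) = if α = β then 1 else 0)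
    (hk : 1 ≤ k) (hi : i ∈ 𝒯.nodes k) (hj : j ∈ 𝒯.nodes k) :
    ∫ x in Ω, 𝒯.bernstein k i x * (𝒯.bernstein k j x * ζ j x) = indicator {i} 1 j := by
  obtain ⟨T₀, hT₀, -⟩ := exists_cellsAt_of_node hk hj
  rw [setIntegral_eq_sum hΩ 𝒯 (hζ.continuousOn_bernstein_mul hZ hk hi hj),
    ← Finset.sum_subset (cellsAt_subset j)]
  · rw [Finset.sum_congr rfl fun T hT => hζ.integral_mul_simplex hdual hk hi hj hT,
      ← Finset.mul_sum, ← Finset.sum_mul, ← volume_patch,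
      inv_mul_cancel_left₀ (volume_patch_pos hT₀).ne']
  · intro T hT hjT
    have hjT' : j ∉ simplex T := fun h => hjT (𝒯.mem_cellsAt.2 ⟨hT, h⟩)
    exact setIntegral_eq_zero_of_forall_eq_zero fun x hx => by
      rw [bernstein_eq_zero hk hj hT hjT' hx, zero_mul, mul_zero]

/-- At a point of a cell only the nodes of that cell contribute, and they correspond bijectively to
the multi-indices. The patch volume in the integral of `b_i` cancels the one in `ζ i`, leaving the
local mass identity. -/
theorem sum_integral_mul (hζ : 𝒯.IsDualFactor k Z ζ) (hΩ : IsPolyhedralDomain Ω)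
    (hmass : ∀ x ∈ stdSimplex ℝ (Fin (d + 1)), ∑ α ∈ Finset.univ.piAntidiag k,
      refIntegral d (bernPoly α) * (eval x (bernPoly α) * eval x (Z α)) = 1)
    (hk : 1 ≤ k) {x : Eu d} (hx : x ∈ closure Ω) :
    ∑ i ∈ 𝒯.nodes k, (∫ y in Ω, 𝒯.bernstein k i y) * (𝒯.bernstein k i x * ζ i x) = 1 := by
  classical
  rw [𝒯.closure_eq] at hx
  obtain ⟨T, hT, hxT⟩ := mem_iUnion₂.1 hx
  rw [← hmass _ (coords_mem hT hxT), ← Finset.sum_filter_of_ne (p := fun i => T ∈ 𝒯.cellsAt i)]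
  · refine Finset.sum_bij (fun i _ => 𝒯.nodeIndex k T i) ?_ ?_ ?_ ?_
    · intro i hi
      rw [Finset.mem_filter] at hi
      exact nodeIndex_mem hk hi.1 hi.2
    · intro i hi j hj h
      rw [Finset.mem_filter] at hi hj
      exact eq_of_nodeIndex_eq hk hi.1 hj.1 hi.2 hj.2 h
    · intro α hα
      obtain ⟨i, hi, hiT, hiα⟩ := exists_node_of_index hk hT hα
      exact ⟨i, Finset.mem_filter.2 ⟨hi, hiT⟩, hiα⟩
    · intro i hi
      rw [Finset.mem_filter] at hi
      have hv := (volume_patch_pos hi.2).ne'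
      rw [integral_bernstein hΩ hk hi.1 hi.2, hζ.mul_eq hi.2 hxT, map_mul]
      field_simp
  · intro i hi hne
    by_contra hiT
    refine hne ?_
    rw [bernstein_eq_zero hk hi hT (fun h => hiT (𝒯.mem_cellsAt.2 ⟨hT, h⟩)) hxT, zero_mul, mul_zero]

theorem abs_mul_le (hζ : 𝒯.IsDualFactor k Z ζ) {B : ℝ}
    (hB : ∀ α ∈ Finset.univ.piAntidiag k, ∀ x ∈ stdSimplex ℝ (Fin (d + 1)),
      |eval x (bernPoly α * Z α)| ≤ B)
    (hk : 1 ≤ k) (hi : i ∈ 𝒯.nodes k) {x : Eu d} (hx : x ∈ 𝒯.patch i) :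
    |𝒯.bernstein k i x * ζ i x| ≤ B * (volume.real (𝒯.patch i))⁻¹ := by
  obtain ⟨T, hT, hxT⟩ := mem_iUnion₂.1 hx
  rw [hζ.mul_eq hT hxT, abs_mul, abs_of_nonneg (by positivity), mul_comm]
  exact mul_le_mul_of_nonneg_right
    (hB _ (nodeIndex_mem hk hi hT) _ (coords_mem (cellsAt_subset i hT) hxT)) (by positivity)

open scoped NNReal in
theorem norm_gradient_le (hζ : 𝒯.IsDualFactor k Z ζ) (hΩ : IsPolyhedralDomain Ω) (hd : 1 ≤ d)
    {L : ℝ≥0} (hL : ∀ α ∈ Finset.univ.piAntidiag k,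
      LipschitzOnWith L (fun x => eval x (bernPoly α * Z α)) (stdSimplex ℝ (Fin (d + 1))))
    (hk : 1 ≤ k) (hi : i ∈ 𝒯.nodes k) {γ : ℝ} (hγ : 𝒯.ShapeRegular γ) (hT : T ∈ 𝒯.cellsAt i)
    {x : Eu d} (hx : x ∈ interior (simplex T)) :
    ‖gradient (fun x => 𝒯.bernstein k i x * ζ i x) x‖ ≤
      L * γ ^ (⌊γ ^ d⌋₊ + 2) * (Metric.diam (𝒯.patch i))⁻¹ * (volume.real (𝒯.patch i))⁻¹ := by
  have hTc := cellsAt_subset i hT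
  obtain ⟨c, r, hr, hb, hdiam⟩ := hγ.1 T hTc
  have hγ2 := hγ.two_le hd hTc
  have hV := volume_patch_pos hT
  -- The chain is `L` for the polynomial on the standard simplex, (2r)⁻¹ for the barycentric
  -- coordinates, and the factor |ω_i|⁻¹.
  have hlip : LipschitzOnWith (Real.toNNReal (volume.real (𝒯.patch i))⁻¹ *
      (L * Real.toNNReal (2 * r)⁻¹)) (fun x => 𝒯.bernstein k i x * ζ i x) (simplex T) := by
    have h1 := (hL _ (nodeIndex_mem hk hi hT)).comp
      (lipschitzWith_coords hTc hr hb).lipschitzOnWith (fun x hx => coords_mem hTc hx)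
    refine LipschitzOnWith.of_dist_le_mul fun y hy z hz => ?_
    have h2 := h1.dist_le_mul y hy z hz
    rw [hζ.mul_eq hT hy, hζ.mul_eq hT hz, Real.dist_eq, ← mul_sub, abs_mul,
      abs_of_pos (inv_pos.2 hV), NNReal.coe_mul, Real.coe_toNNReal _ (inv_pos.2 hV).le, mul_assoc]
    exact mul_le_mul_of_nonneg_left h2 (inv_pos.2 hV).le
  rw [norm_gradient]
  refine (norm_fderiv_le_of_lipschitzOn ℝ (mem_interior_iff_mem_nhds.1 hx) hlip).trans ?_
  rw [NNReal.coe_mul, NNReal.coe_mul, Real.coe_toNNReal _ (by positivity),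
    Real.coe_toNNReal _ (by positivity)]
  have hD : 0 < Metric.diam (𝒯.patch i) := by
    refine (hγ.diam_pos hd hTc).trans_le (Metric.diam_mono ?_
      (isCompact_biUnion_simplex _).isBounded)
    exact subset_biUnion_of_mem (u := fun T => simplex T) hT
  -- The last factor γ comes from diam T ≤ γr; the 2 of the patch estimate is kept in 2r.
  have hDr : Metric.diam (𝒯.patch i) ≤ γ ^ (⌊γ ^ d⌋₊ + 2) * (2 * r) := by
    refine (hγ.diam_patch_le hΩ hd hT).trans ?_
    calc 2 * γ ^ (⌊γ ^ d⌋₊ + 1) * Metric.diam (simplex T)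
        ≤ 2 * γ ^ (⌊γ ^ d⌋₊ + 1) * (γ * r) := mul_le_mul_of_nonneg_left hdiam (by positivity)
      _ = γ ^ (⌊γ ^ d⌋₊ + 2) * (2 * r) := by ring
  have hinv : (2 * r)⁻¹ ≤ γ ^ (⌊γ ^ d⌋₊ + 2) * (Metric.diam (𝒯.patch i))⁻¹ := by
    rw [← div_eq_mul_inv, le_div_iff₀ hD, inv_mul_le_iff₀ (by positivity), mul_comm]
    exact hDr
  calc (volume.real (𝒯.patch i))⁻¹ * (L * (2 * r)⁻¹)
      ≤ (volume.real (𝒯.patch i))⁻¹ *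
        (L * (γ ^ (⌊γ ^ d⌋₊ + 2) * (Metric.diam (𝒯.patch i))⁻¹)) := by gcongr
    _ = _ := by ring

end IsDualFactor

/-- Almost every point of a patch is an interior point of one of its cells. -/
theorem ae_mem_interior_of_patch (𝒯 : Triangulation Ω) (i : Eu d) :
    ∀ᵐ x ∂volume.restrict (𝒯.patch i), ∃ T ∈ 𝒯.cellsAt i, x ∈ interior (simplex T) := by
  rw [patch, ae_restrict_iff' (isCompact_biUnion_simplex _).measurableSet]
  have hnull : ∀ᵐ x : Eu d, ∀ T ∈ 𝒯.cellsAt i, x ∉ frontier (simplex T) := by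
    rw [Filter.eventually_all_finset]
    intro T _
    exact measure_eq_zero_iff_ae_notMem.1 ((convex_simplex T).addHaar_frontier volume)
  filter_upwards [hnull] with x hx hxp
  obtain ⟨T, hT, hxT⟩ := mem_iUnion₂.1 hxp
  refine ⟨T, hT, ?_⟩
  by_contra hint
  refine hx T hT ?_
  rw [(isCompact_simplex T).isClosed.frontier_eq]
  exact ⟨hxT, hint⟩

end Triangulation

end LagrangeFE

end

/-! ### Assembly of the global dual basis. -/

theorem proposition2p7 (d k : ℕ) (hd : 1 ≤ d) (hk : 1 ≤ k) :
    ∃ (C₁ : ℝ) (C₂ : ℝ → ℝ),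
      ∀ (Ω : Set (LagrangeFE.Eu d)), LagrangeFE.IsPolyhedralDomain Ω →
      ∀ 𝒯 : LagrangeFE.Triangulation Ω,
      ∃ ψ : LagrangeFE.Eu d → LagrangeFE.Eu d → ℝ,
        -- continuous piecewise polynomials of degree `3k`
        (∀ i ∈ 𝒯.nodes k,
          ψ i ∈ LagrangeFE.lagrangeSpace Ω 𝒯.cells (3 * k) ∧ ContinuousOn (ψ i) (closure Ω)) ∧
        -- product structure
        (∀ i ∈ 𝒯.nodes k,
          (∃ ζ ∈ LagrangeFE.lagrangeSpace (interior (𝒯.patch i)) (𝒯.cellsAt i) (2 * k),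
            ∀ x, ψ i x = 𝒯.bernstein k i x * ζ x) ∧
          tsupport (ψ i) ⊆ tsupport (𝒯.bernstein k i)) ∧
        -- biorthogonality
        (∀ i ∈ 𝒯.nodes k, ∀ j ∈ 𝒯.nodes k,
          IntegrableOn (fun x => 𝒯.bernstein k i x * ψ j x) Ω ∧
          ∫ x in Ω, 𝒯.bernstein k i x * ψ j x = Set.indicator {i} 1 j) ∧
        -- boundedness
        (∀ i ∈ 𝒯.nodes k,
          eLpNorm (ψ i) ∞ (volume.restrict (𝒯.patch i)) ≤
            ENNReal.ofReal (C₁ * (volume.real (𝒯.patch i))⁻¹)) ∧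
        (∀ γ : ℝ, 𝒯.ShapeRegular γ → ∀ i ∈ 𝒯.nodes k,
          ∃ g : LagrangeFE.Eu d → LagrangeFE.Eu d,
            IntegrableOn g Ω ∧ LagrangeFE.HasWeakGradient Ω (ψ i) g ∧
            eLpNorm g ∞ (volume.restrict (𝒯.patch i)) ≤
              ENNReal.ofReal
                (C₂ γ * (Metric.diam (𝒯.patch i))⁻¹ * (volume.real (𝒯.patch i))⁻¹)) ∧
        -- preservation of mass
        (∀ x ∈ closure Ω,
          ∑ i ∈ 𝒯.nodes k, (∫ y in Ω, 𝒯.bernstein k i y) * ψ i x = 1) := by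
  obtain ⟨Z, hdeg, hequi, hdual, hmass⟩ := LagrangeFE.exists_equivariant_local_dual
    (LagrangeFE.isSimplexIntegral_refIntegral d) k
  obtain ⟨B, hB⟩ := LagrangeFE.exists_bound_on_stdSimplex (Finset.univ.piAntidiag k)
    fun α : Fin (d + 1) → ℕ => LagrangeFE.bernPoly α * Z α
  obtain ⟨L, hL⟩ := LagrangeFE.exists_lipschitz_on_stdSimplex (Finset.univ.piAntidiag k)
    fun α : Fin (d + 1) → ℕ => LagrangeFE.bernPoly α * Z α
  -- The constants come from the reference simplex and are fixed before Ω and the triangulation are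
  -- chosen.
  refine ⟨B, fun γ => L * γ ^ (⌊γ ^ d⌋₊ + 2), fun Ω hΩ 𝒯 => ?_⟩
  obtain ⟨ζ, hζ⟩ := 𝒯.exists_isDualFactor k hequi
  have hpoly : ∀ i ∈ 𝒯.nodes k, ∀ T ∈ 𝒯.cells, LagrangeFE.IsPolyOn (3 * k)
      (LagrangeFE.simplex T) fun x => 𝒯.bernstein k i x * ζ i x := fun i hi T hT =>
    (hζ.isPolyOn_mul hdeg hk hi hT).mono (by omega)
  have hcov := 𝒯.subset_biUnion_cells
  refine ⟨fun i x => 𝒯.bernstein k i x * ζ i x, fun i hi => ⟨⟨?_, hpoly i hi⟩, ?_⟩,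
    fun i hi => ⟨⟨ζ i, ⟨?_, ?_⟩, fun x => rfl⟩, ?_⟩, fun i hi j hj => ⟨?_, ?_⟩, fun i hi => ?_,
    fun γ hγ i hi => ⟨gradient fun x => 𝒯.bernstein k i x * ζ i x, ?_, ?_, ?_⟩, fun x hx => ?_⟩
  · exact LagrangeFE.memW11_of_piecewise hΩ.isOpen hcov (hpoly i hi)
  · exact LagrangeFE.Triangulation.continuousOn_closure_of_piecewise (hpoly i hi)
  · exact LagrangeFE.memW11_of_piecewise isOpen_interior interior_subset
      fun T hT => hζ.isPolyOn hdeg hT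
  · exact fun T hT => hζ.isPolyOn hdeg hT
  · exact closure_mono (Function.support_mul_subset_left _ _)
  · exact ((hζ.continuousOn_bernstein_mul hdeg hk hi hj).integrableOn_compact
      𝒯.isCompact_closure).mono_set subset_closure
  · exact hζ.biorthogonal hΩ hdeg hdual hk hi hj
  · rw [eLpNorm_exponent_top]
    refine eLpNormEssSup_le_of_ae_bound ?_
    refine (ae_restrict_iff' (LagrangeFE.isCompact_biUnion_simplex _).measurableSet).2
      (ae_of_all _ fun x hx => ?_)
    exact hζ.abs_mul_le hB hk hi hx
  · exact LagrangeFE.integrableOn_gradient_of_piecewise hΩ.isOpen hcov (hpoly i hi)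
  · exact LagrangeFE.hasWeakGradient_of_piecewise hΩ.isOpen hcov (hpoly i hi)
  · rw [eLpNorm_exponent_top]
    refine eLpNormEssSup_le_of_ae_bound ?_
    filter_upwards [𝒯.ae_mem_interior_of_patch i] with x hx
    obtain ⟨T, hT, hxT⟩ := hx
    exact hζ.norm_gradient_le hΩ hd hL hk hi hγ hT hxT
  · exact hζ.sum_integral_mul hΩ hmass hk hx
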